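/- Let $p,k\ge 1$ be integers and $m>0$. Let $X\sim N_p(\theta,\sigma^2I_p)$ and $S^2\sim\sigma^2\chi^2_k$ be independent, with $(\theta,\sigma)$ unknown in $\Theta(m)=\{(\theta,\sigma)\in\mathbb R^p\times(0,\infty):\ \|\theta\|/\sigma\le m\}$. The loss for estimating $\theta$ by $d$ is $\|d-\theta\|^2/\sigma^2$, and $R((\theta,\sigma),\delta)\in[0,\infty]$ denotes the risk (expected loss) of an estimator $\delta(X,S^2)$. An estimator $\delta'$ *dominates* $\delta$ if $R((\theta,\sigma),\delta')\le R((\theta,\sigma),\delta)$ on all of $\Theta(m)$ with strict inequality at some point of $\Theta(m)$; $\delta$ is *inadmissible* if some measurable estimator dominates it. For measurable $h$ let $$\delta_h(X,S^2)=h(T)\,X,\qquad T=\|X\|^2/S^2,$$ and let $$h(m,l,t)=\frac{m^2}{p}\,\frac{F\left(\frac{k+p-l}{2}+1,\frac p2+1,\frac{m^2t}{2(1+t)}\right)}{F\left(\frac{k+p-l}{2}+1,\frac p2,\frac{m^2t}{2(1+t)}\right)},\qquad F(a,b,z)=\sum_{i\ge0}\frac{(a)_i}{(b)_i}\frac{z^i}{i!},\qquad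 (c)_i=\prod_{j=0}^{i-1}(c+j).$$ Let $\nu$ be Lebesgue measure on $\mathbb R$. Let $h_1:\mathbb R\to\mathbb R$ be measurable. (a) Let $h_2$ be measurable with $h_1(t)\ge h_2(t)$ and $\frac{h_1(t)+h_2(t)}2\ge h(m,0,t)$ for all $t>0$, and $\nu\{t>0:h_1(t)\ne h_2(t)\}>0$. If $\delta_{h_2}$ has finite risk at some point of $\Theta(m)$, then $\delta_{h_2}$ dominates $\delta_{h_1}$. (b) Let $\underline S$ be a measurable subset of $S=\{t>0: h_1(t)>h(m,0,t)\}$ with $\nu(\underline S)>0$. Then $\delta_{h_1}$ is inadmissible. Moreover $\delta_{h_1}$ is dominated by $\delta_h$ with $h(t)=h_1(t)\wedge h(m,0,t)$, provided this $\delta_h$ has finite risk at some point of $\Theta(m)$. It is also dominated by every $\delta_h$ with $h=h_1 1_{\underline S^c}+h^*1_{\underline S}$, where $h^*$ is measurable, $2h(m,0,t)-h_1(t)\le h^*(t)\le h_1(t)$ for all $t\in\underline S$, and $\nu\{t\in\underline S:h^*(t)\neq h_1(t)\}>0$, provided this $\delta_h$ has finite risk at some point of $\Theta(m)$. (c) Let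 $\delta_{BU,0}$ be the generalized Bayes estimator, i.e. the unique minimizer of the posterior expected loss for every observation $(x,s^2)$ with $s^2>0$, for the improper prior under which $\theta\mid\sigma^2$ is uniform on the sphere of radius $m\sigma$ centered at $0$ and $\sigma^2$ has density $(\sigma^2)^{-1}$ on $(0,\infty)$. Then $\delta_{BU,0}(X,S^2)=h(m,0,T)\,X$. If $h_1(t)\ge h(m,0,t)$ for all $t>0$ and $\nu\{t>0:h_1(t)\ne h(m,0,t)\}>0$, then $\delta_{BU,0}$ dominates $\delta_{h_1}$. -/

import Mathlib

open MeasureTheory ProbabilityTheory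

namespace BoundedSNR

noncomputable section

/-! ### The normal canonical model, loss, risk and dominance -/

/-- The sample space of the location statistic `X`, and the space of the mean `θ`. -/
abbrev Vec (p : ℕ) : Type := EuclideanSpace ℝ (Fin p)

/-- An estimator of `θ`: a function of the observation `(x, w)`, where `w` is the value of `S²`. -/
abbrev Estimator (p : ℕ) : Type := Vec p × ℝ → Vec p

/-- The chi-square distribution with `k` degrees of freedom. -/
def chiSquare (k : ℕ) : Measure ℝ := gammaMeasure ((k : ℝ) / 2) (1 / 2)

/-- The joint law of `(X, S²)`, where `X ∼ N_p(θ, σ² I_p)` and `S² ∼ σ² χ²_k` are independent. -/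
def model (p k : ℕ) (θ : Vec p) (σ : ℝ) : Measure (Vec p × ℝ) :=
  (multivariateGaussian θ (σ ^ 2 • (1 : Matrix (Fin p) (Fin p) ℝ))).prod
    ((chiSquare k).map (fun y => σ ^ 2 * y))

/-- The parameter space `Θ(m)`, a set of pairs `(θ, σ)`. -/
def paramSpace (p : ℕ) (m : ℝ) : Set (Vec p × ℝ) :=
  {q | 0 < q.2 ∧ ‖q.1‖ / q.2 ≤ m}

/-- The scale invariant squared error loss `‖d - θ‖² / σ²`. -/
def loss {p : ℕ} (θ : Vec p) (σ : ℝ) (d : Vec p) : ENNReal :=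
  ENNReal.ofReal (‖d - θ‖ ^ 2 / σ ^ 2)

/-- The risk (expected loss) of the estimator `δ` at `(θ, σ)`, with values in `[0, ∞]`. -/
def risk (p k : ℕ) (θ : Vec p) (σ : ℝ) (δ : Estimator p) : ENNReal :=
  ∫⁻ y, loss θ σ (δ y) ∂(model p k θ σ)

/-- `δ'` dominates `δ` on `Θ(m)`: its risk is nowhere larger, and somewhere strictly smaller. -/
def Dominates (p k : ℕ) (m : ℝ) (δ' δ : Estimator p) : Prop :=
  (∀ q ∈ paramSpace p m, risk p k q.1 q.2 δ' ≤ risk p k q.1 q.2 δ) ∧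
    ∃ q ∈ paramSpace p m, risk p k q.1 q.2 δ' < risk p k q.1 q.2 δ

/-- `δ` is inadmissible on `Θ(m)`: some (measurable) estimator dominates it. -/
def Inadmissible (p k : ℕ) (m : ℝ) (δ : Estimator p) : Prop :=
  ∃ δ' : Estimator p, Measurable δ' ∧ Dominates p k m δ' δ

/-- The risk of `δ` is finite at one point of `Θ(m)` at least. -/
def HasFiniteRisk (p k : ℕ) (m : ℝ) (δ : Estimator p) : Prop :=
  ∃ q ∈ paramSpace p m, risk p k q.1 q.2 δ < ⊤

/-- The equivariant estimator `δ_h (X, S²) = h(‖X‖² / S²) X` with multiplier `h`. -/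
def equivariant {p : ℕ} (h : ℝ → ℝ) : Estimator p :=
  fun y => h (‖y.1‖ ^ 2 / y.2) • y.1

/-! ### The benchmark multiplier `h(m, l, t)` -/

/-- The confluent hypergeometric function `F(a, b, z) = ∑ (a)_i / (b)_i * z^i / i!`. -/
def confluentF (a b z : ℝ) : ℝ :=
  ∑' i : ℕ, (ascPochhammer ℝ i).eval a / (ascPochhammer ℝ i).eval b *
    (z ^ i / (Nat.factorial i : ℝ))

/-- The multiplier `h(m, l, t)` of the boundary uniform Bayes estimator. -/
def hBU (p k : ℕ) (m l t : ℝ) : ℝ :=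
  m ^ 2 / p *
    (confluentF (((k : ℝ) + p - l) / 2 + 1) ((p : ℝ) / 2 + 1) (m ^ 2 * t / (2 * (1 + t))) /
      confluentF (((k : ℝ) + p - l) / 2 + 1) ((p : ℝ) / 2) (m ^ 2 * t / (2 * (1 + t))))

/-! ### Bayes estimators with respect to the boundary uniform prior -/

/-- The uniform probability measure on the unit sphere of `ℝ^p`. -/
def sphereUniform (p : ℕ) : Measure (Metric.sphere (0 : Vec p) 1) :=
  ((volume : Measure (Vec p)).toSphere Set.univ)⁻¹ • (volume : Measure (Vec p)).toSphere

/-- The (improper) boundary uniform prior on pairs `(θ, σ)`: the variance `v = σ²` has density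
`v ^ (l / 2 - 1)` on `(0, ∞)`, and, given `σ`, `θ` is uniform on the sphere of radius `m σ`. -/
def boundaryUniformPrior (p : ℕ) (m l : ℝ) : Measure (Vec p × ℝ) :=
  ((sphereUniform p).prod
      (((volume : Measure ℝ).restrict (Set.Ioi 0)).withDensity
        (fun v => ENNReal.ofReal (v ^ (l / 2 - 1))))).map
    (fun r => ((m * √r.2) • (r.1 : Vec p), √r.2))

/-- The joint density of `(X, S²)` at `(x, w)`: the `N_p(θ, σ² I_p)` density at `x` times the
`σ² χ²_k` density (a gamma density of shape `k / 2` and rate `1 / (2 σ²)`) at `w`. -/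
def likelihood (p k : ℕ) (θ : Vec p) (σ : ℝ) (x : Vec p) (w : ℝ) : ℝ :=
  (2 * Real.pi * σ ^ 2) ^ (-(p : ℝ) / 2) * Real.exp (-(‖x - θ‖ ^ 2) / (2 * σ ^ 2)) *
    gammaPDFReal ((k : ℝ) / 2) (1 / (2 * σ ^ 2)) w

/-- The posterior expected loss of the decision `d` given `(x, w)`, for the prior `prior`, up to
the normalizing constant of the posterior (which does not depend on `d`). -/
def posteriorLoss (p k : ℕ) (prior : Measure (Vec p × ℝ)) (x : Vec p) (w : ℝ) (d : Vec p) :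
    ENNReal :=
  ∫⁻ q, ENNReal.ofReal (likelihood p k q.1 q.2 x w) * loss q.1 q.2 d ∂prior

/-- `δ` is the (generalized) Bayes estimator for `prior`: for every observation `(x, w)` with
`w > 0`, the decision `δ (x, w)` is the unique minimizer of the posterior expected loss. -/
def IsBayes (p k : ℕ) (prior : Measure (Vec p × ℝ)) (δ : Estimator p) : Prop :=
  ∀ (x : Vec p) (w : ℝ), 0 < w → ∀ d : Vec p, d ≠ δ (x, w) →
    posteriorLoss p k prior x w (δ (x, w)) < posteriorLoss p k prior x w d

end

end BoundedSNR

open MeasureTheory ProbabilityTheory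

namespace BoundedSNR

noncomputable section

open scoped RealInnerProductSpace

/-! ### Hypergeometric series -/

/-! Condition on T. With λ = ‖θ‖/σ, the risk of δ_h is the integral over t > 0 of w_λ(t) (h(t)² − 2
h(t) h(λ,0,t)), w_λ > 0, plus a term free of h (`risk_equivariant`). Hence h(λ,0,t) is the best
multiplier at λ, and replacing h₁ by h₂ changes the integrand by −w_λ (h₁ − h₂)(h₁ + h₂ −
2h(λ,0,t)). Since h(λ,0,t) is nondecreasing in λ (`hBU_mono`), a midpoint of at least h(m,0,t)
settles every λ ≤ m at once (`risk_equivariant_le`).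

Strictness is checked at θ = 0, where the integrand is just w_0 h² and h₁ + h₂ ≥ 2h(m,0,t) > 0
(`dominates_equivariant`). A strict inequality of integrals needs the smaller one finite;
`risk_origin_lt_top` carries finiteness from any parameter point to the origin.

The risk formula rests on two averages. Averaging over the direction of X gives the series `limitF`,
whose coefficients are spherical moments read off Gaussian ones (`integral_sphere_exp_inner`,
`integral_sphere_inner_mul_exp`). Integrating out S² is then a Laplace transform that turns `limitF`
into F (`laplace_limitF`). The Bayes claim uses the same two computations with the direction of θ
and the precision 1/σ² as variables: the posterior loss is a quadratic in d centred at h(m,0,T) x.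
Monotonicity in λ is a Chebyshev sum argument on power series (`confluentF_ratio_mono`). -/

/-- The Pochhammer symbol `(a)_i` of a real number. -/
abbrev poch (a : ℝ) (i : ℕ) : ℝ := (ascPochhammer ℝ i).eval a

lemma poch_succ (a : ℝ) (i : ℕ) : poch a (i + 1) = poch a i * (a + i) :=
  ascPochhammer_succ_eval i a

lemma poch_succ_left (a : ℝ) (i : ℕ) : poch a (i + 1) = a * poch (a + 1) i := by
  induction i with
  | zero => simp [poch]
  | succ i ih =>
    rw [poch_succ, ih, poch_succ]
    push_cast
    ring

lemma poch_pos {a : ℝ} (ha : 0 < a) (i : ℕ) : 0 < poch a i := by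
  induction i with
  | zero => simp [poch]
  | succ i ih => rw [poch_succ]; positivity

lemma Gamma_add_nat {a : ℝ} (ha : 0 < a) (i : ℕ) :
    Real.Gamma (a + i) = poch a i * Real.Gamma a := by
  induction i with
  | zero => simp [poch]
  | succ i ih =>
    rw [Nat.cast_succ, ← add_assoc, Real.Gamma_add_one (by positivity), ih, poch_succ]
    ring

/-- The `i`-th term of the confluent hypergeometric series. -/
abbrev confluentTerm (a b z : ℝ) (i : ℕ) : ℝ :=
  (ascPochhammer ℝ i).eval a / (ascPochhammer ℝ i).eval b * (z ^ i / (Nat.factorial i : ℝ))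

lemma confluentTerm_succ {a b : ℝ} (hb : 0 < b) (z : ℝ) (i : ℕ) :
    confluentTerm a b z (i + 1) =
      (a + i) / (b + i) * (z / (i + 1)) * confluentTerm a b z i := by
  have h1 := poch_succ a i
  have h2 := poch_succ b i
  have h3 := (poch_pos hb i).ne'
  have h4 : b + i ≠ 0 := by positivity
  simp only [poch] at h1 h2 h3
  simp only [confluentTerm, h1, h2, pow_succ, Nat.factorial_succ]
  push_cast
  field_simp

lemma summable_confluentTerm (a : ℝ) {b : ℝ} (hb : 0 < b) (z : ℝ) :
    Summable (confluentTerm a b z) := by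
  have hlim : Filter.Tendsto (fun i : ℕ => (a + i) / (b + i) * (z / (i + 1)))
      Filter.atTop (nhds (1 * 0)) := by
    refine Filter.Tendsto.mul ?_ ?_
    · have := tendsto_add_mul_div_add_mul_atTop_nhds a b (1 : ℝ) (one_ne_zero (α := ℝ))
      simpa using this
    · exact Filter.Tendsto.div_atTop tendsto_const_nhds
        (Filter.tendsto_atTop_add_const_right _ _ tendsto_natCast_atTop_atTop)
  rw [mul_zero] at hlim
  have hev : ∀ᶠ i : ℕ in Filter.atTop, ‖(a + i) / (b + i) * (z / (i + 1))‖ < 1 / 2 := by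
    have := hlim.norm
    rw [norm_zero] at this
    exact this.eventually (gt_mem_nhds (by norm_num))
  refine summable_of_ratio_norm_eventually_le (r := 1 / 2) (by norm_num) ?_
  filter_upwards [hev] with i hi
  rw [confluentTerm_succ hb, norm_mul]
  gcongr

lemma confluentTerm_nonneg {a b z : ℝ} (ha : 0 < a) (hb : 0 < b) (hz : 0 ≤ z) (i : ℕ) :
    0 ≤ confluentTerm a b z i := by
  have h1 := poch_pos ha i
  have h2 := poch_pos hb i
  simp only [poch] at h1 h2
  positivity

lemma one_le_confluentF {a b z : ℝ} (ha : 0 < a) (hb : 0 < b) (hz : 0 ≤ z) :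
    1 ≤ confluentF a b z := by
  have := (summable_confluentTerm a hb z).le_tsum 0 (fun i _ => confluentTerm_nonneg ha hb hz i)
  have h0 : confluentTerm a b z 0 = 1 := by simp [confluentTerm]
  rw [← h0]
  exact this

lemma confluentF_pos {a b z : ℝ} (ha : 0 < a) (hb : 0 < b) (hz : 0 ≤ z) :
    0 < confluentF a b z :=
  zero_lt_one.trans_le (one_le_confluentF ha hb hz)

lemma confluentF_zero (a : ℝ) {b : ℝ} : confluentF a b 0 = 1 := by
  rw [confluentF, tsum_eq_single 0]
  · simp
  · intro i hi
    simp [hi]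

lemma measurable_confluentF (a : ℝ) {b : ℝ} (hb : 0 < b) : Measurable (confluentF a b) := by
  refine measurable_of_tendsto_metrizable
    (f := fun n z => ∑ i ∈ Finset.range n, confluentTerm a b z i) (fun n => ?_) ?_
  · exact Finset.measurable_sum _ (fun i _ => by fun_prop)
  · rw [tendsto_pi_nhds]
    exact fun z => (summable_confluentTerm a hb z).hasSum.tendsto_sum_nat

/-! ### Monotonicity of ratios of power series. -/

/-- Symmetrization: a double sum is unchanged by swapping its indices, so termwise comparison is
only needed after adding the swapped term. -/
lemma tsum_le_tsum_of_add_swap_le {f g : ℕ × ℕ → ℝ} (hf : Summable f) (hg : Summable g)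
    (h : ∀ i j, g (i, j) + g (j, i) ≤ f (i, j) + f (j, i)) : ∑' x, g x ≤ ∑' x, f x := by
  have hf' : Summable fun x : ℕ × ℕ => f x.swap := (Equiv.prodComm ℕ ℕ).summable_iff.mpr hf
  have hg' : Summable fun x : ℕ × ℕ => g x.swap := (Equiv.prodComm ℕ ℕ).summable_iff.mpr hg
  have hswf : ∑' x : ℕ × ℕ, f x.swap = ∑' x, f x := (Equiv.prodComm ℕ ℕ).tsum_eq f
  have hswg : ∑' x : ℕ × ℕ, g x.swap = ∑' x, g x := (Equiv.prodComm ℕ ℕ).tsum_eq g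
  have key : ∑' x : ℕ × ℕ, (g x + g x.swap) ≤ ∑' x : ℕ × ℕ, (f x + f x.swap) :=
    (hg.add hg').tsum_le_tsum (fun x => h x.1 x.2) (hf.add hf')
  rw [hf.tsum_add hf', hg.tsum_add hg', hswf, hswg] at key
  linarith

/-- Both factors have the sign of i − j, as in Chebyshev's sum inequality. -/
lemma sub_mul_pow_sub_nonneg {c : ℕ → ℝ} (hc : Monotone c) {z z' : ℝ} (hz : 0 ≤ z)
    (hzz' : z ≤ z') (i j : ℕ) :
    0 ≤ (c i - c j) * (z' ^ i * z ^ j - z' ^ j * z ^ i) := by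
  have hz' : 0 ≤ z' := hz.trans hzz'
  have aux : ∀ i j : ℕ, i ≤ j → z' ^ i * z ^ j ≤ z' ^ j * z ^ i := by
    intro i j hij
    obtain ⟨n, rfl⟩ := Nat.exists_eq_add_of_le hij
    have h1 : z ^ n ≤ z' ^ n := pow_le_pow_left₀ hz hzz' n
    calc z' ^ i * z ^ (i + n) = (z' ^ i * z ^ i) * z ^ n := by ring
      _ ≤ (z' ^ i * z ^ i) * z' ^ n := mul_le_mul_of_nonneg_left h1 (by positivity)
      _ = z' ^ (i + n) * z ^ i := by ring
  rcases le_total i j with hij | hij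
  · exact mul_nonneg_of_nonpos_of_nonpos (sub_nonpos.2 (hc hij)) (sub_nonpos.2 (aux i j hij))
  · exact mul_nonneg (sub_nonneg.2 (hc hij)) (sub_nonneg.2 (aux j i hij))

/-- A ratio of power series with nonnegative coefficients is monotone when the ratio of the
coefficients is. -/
lemma tsum_mul_tsum_le_of_monotone {c d : ℕ → ℝ} (hc : Monotone c) (hd : ∀ i, 0 ≤ d i)
    {z z' : ℝ} (hz : 0 ≤ z) (hzz' : z ≤ z')
    (hD : Summable fun i => d i * z ^ i) (hD' : Summable fun i => d i * z' ^ i)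
    (hN : Summable fun i => c i * (d i * z ^ i))
    (hN' : Summable fun i => c i * (d i * z' ^ i)) :
    (∑' i, c i * (d i * z ^ i)) * (∑' i, d i * z' ^ i) ≤
      (∑' i, c i * (d i * z' ^ i)) * (∑' i, d i * z ^ i) := by
  have h1 := tsum_mul_tsum_of_summable_norm hN.norm hD'.norm
  have h2 := tsum_mul_tsum_of_summable_norm hN'.norm hD.norm
  have s1 := summable_mul_of_summable_norm hN.norm hD'.norm
  have s2 := summable_mul_of_summable_norm hN'.norm hD.norm
  rw [h1, h2]
  refine tsum_le_tsum_of_add_swap_le s2 s1 (fun i j => ?_)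
  -- This product is exactly the symmetrized (i, j) term of the difference of the two sides.
  have h := mul_nonneg (mul_nonneg (hd i) (hd j)) (sub_mul_pow_sub_nonneg hc hz hzz' i j)
  refine sub_nonneg.1 (h.trans_eq ?_)
  dsimp only
  ring

/-- The function `z ↦ z F(a, b + 1, z) / F(a, b, z)` is nondecreasing on `[0, ∞)`. -/
lemma confluentF_ratio_mono {a b : ℝ} (ha : 1 ≤ a) (hb : 0 < b) {z z' : ℝ} (hz : 0 ≤ z)
    (hzz' : z ≤ z') :
    z * (confluentF a (b + 1) z / confluentF a b z) ≤
      z' * (confluentF a (b + 1) z' / confluentF a b z') := by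
  have ha0 : 0 < a := by linarith
  -- `c` is the ratio of the coefficients of z F(a, b+1, z) and F(a, b, z). Its growth comes from
  -- (j+1)(a+j−1) − j(a+j) = a − 1 ≥ 0. At j = 0 the numerator vanishes, so `c 0 = 0` even when a =
  -- 1 makes the denominator 0.
  let c : ℕ → ℝ := fun j => j * b / (a + j - 1)
  let d : ℕ → ℝ := fun j => poch a j / poch b j * (1 / (Nat.factorial j : ℝ))
  have hden : ∀ j : ℕ, 1 ≤ j → 0 < a + j - 1 := by
    intro j hj
    have : (1 : ℝ) ≤ j := by exact_mod_cast hj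
    linarith
  have hc : Monotone c := by
    refine monotone_nat_of_le_succ (fun j => ?_)
    rcases Nat.eq_zero_or_pos j with rfl | hj
    · simp only [c]
      have := hden 1 le_rfl
      push_cast at this ⊢
      rw [zero_mul, zero_div]
      positivity
    · have h1 := hden j hj
      have h2 := hden (j + 1) (by omega)
      simp only [c]
      rw [div_le_div_iff₀ h1 h2]
      push_cast
      nlinarith
  have hd : ∀ j, 0 ≤ d j := fun j => by
    have h1 := poch_pos ha0 j
    have h2 := poch_pos hb j
    simp only [d]; positivity
  have hterm : ∀ (w : ℝ) (j : ℕ), d j * w ^ j = confluentTerm a b w j := fun w j => by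
    simp only [d, confluentTerm, poch]; ring
  have hshift : ∀ (w : ℝ) (j : ℕ),
      c (j + 1) * (d (j + 1) * w ^ (j + 1)) = w * confluentTerm a (b + 1) w j := fun w j => by
    have h1 := poch_succ_left b j
    have h2 := poch_succ a j
    have h3 := (poch_pos (by linarith : 0 < b + 1) j).ne'
    have h4 : a + j ≠ 0 := by positivity
    simp only [c, d, confluentTerm, h1, h2, Nat.factorial_succ]
    push_cast
    simp only [poch] at h3 ⊢
    rw [show a + ((j : ℝ) + 1) - 1 = a + j by ring, pow_succ]
    field_simp
  have hc0 : c 0 = 0 := by simp [c]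
  have hDsum : ∀ w, Summable fun i => d i * w ^ i := fun w => by
    simp_rw [hterm]; exact summable_confluentTerm a hb w
  have hNsum : ∀ w, Summable fun i => c i * (d i * w ^ i) := fun w => by
    rw [← summable_nat_add_iff 1]
    simp_rw [hshift]
    exact (summable_confluentTerm a (by linarith) w).mul_left w
  have hD : ∀ w, ∑' i, d i * w ^ i = confluentF a b w := fun w => by
    simp_rw [hterm]; rfl
  have hN : ∀ w, ∑' i, c i * (d i * w ^ i) = w * confluentF a (b + 1) w := fun w => by
    rw [(hNsum w).tsum_eq_zero_add]
    simp_rw [hshift]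
    rw [hc0, zero_mul, zero_add, tsum_mul_left]
    rfl
  have := tsum_mul_tsum_le_of_monotone hc hd hz hzz' (hDsum z) (hDsum z')
    (hNsum z) (hNsum z')
  rw [hN, hN, hD, hD] at this
  rw [← mul_div_assoc, ← mul_div_assoc,
    div_le_div_iff₀ (confluentF_pos ha0 hb hz) (confluentF_pos ha0 hb (hz.trans hzz'))]
  exact this

/-! ### Laplace transforms of the confluent limit series. -/

/-- The confluent limit series `∑ z ^ i / (i! (b)_i)`. -/
def limitF (b z : ℝ) : ℝ := ∑' i : ℕ, z ^ i / ((Nat.factorial i : ℝ) * poch b i)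

lemma summable_limitF {b : ℝ} (hb : 0 < b) (z : ℝ) :
    Summable fun i : ℕ => z ^ i / ((Nat.factorial i : ℝ) * poch b i) := by
  have hlim : Filter.Tendsto (fun i : ℕ => z * (1 / ((i + 1 : ℝ) * (b + i))))
      Filter.atTop (nhds (z * 0)) := by
    refine Filter.Tendsto.const_mul _ (Filter.Tendsto.div_atTop tendsto_const_nhds ?_)
    exact (Filter.tendsto_atTop_add_const_right _ _ tendsto_natCast_atTop_atTop).atTop_mul_atTop₀
      (Filter.tendsto_atTop_add_const_left _ _ tendsto_natCast_atTop_atTop)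
  rw [mul_zero] at hlim
  have hev : ∀ᶠ i : ℕ in Filter.atTop, ‖z * (1 / ((i + 1 : ℝ) * (b + i)))‖ < 1 / 2 := by
    have := hlim.norm
    rw [norm_zero] at this
    exact this.eventually (gt_mem_nhds (by norm_num))
  refine summable_of_ratio_norm_eventually_le (r := 1 / 2) (by norm_num) ?_
  filter_upwards [hev] with i hi
  have h1 := (poch_pos hb i).ne'
  have h2 : b + i ≠ 0 := by positivity
  have : z ^ (i + 1) / ((Nat.factorial (i + 1) : ℝ) * poch b (i + 1)) =
      z * (1 / ((i + 1 : ℝ) * (b + i))) * (z ^ i / ((Nat.factorial i : ℝ) * poch b i)) := by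
    rw [poch_succ, Nat.factorial_succ, pow_succ]
    push_cast
    field_simp
  rw [this, norm_mul]
  gcongr

lemma integrableOn_rpow_mul_exp {a c : ℝ} (ha : 0 < a) (hc : 0 < c) :
    IntegrableOn (fun s : ℝ => s ^ (a - 1) * Real.exp (-(c * s))) (Set.Ioi 0) := by
  have := integrableOn_rpow_mul_exp_neg_mul_rpow (p := 1) (s := a - 1) (by linarith) one_pos hc
  simpa using this

/-- A Laplace transform of the confluent limit series is a confluent hypergeometric function. -/
lemma laplace_limitF {a b c q : ℝ} (ha : 0 < a) (hb : 0 < b) (hc : 0 < c) (hq : 0 ≤ q) :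
    IntegrableOn (fun s : ℝ => s ^ (a - 1) * Real.exp (-(c * s)) * limitF b (q * s)) (Set.Ioi 0) ∧
    ∫ s in Set.Ioi (0 : ℝ), s ^ (a - 1) * Real.exp (-(c * s)) * limitF b (q * s) =
      (1 / c) ^ a * Real.Gamma a * confluentF a b (q / c) := by
  let G : ℕ → ℝ → ℝ := fun i s =>
    s ^ (a - 1) * Real.exp (-(c * s)) * ((q * s) ^ i / ((Nat.factorial i : ℝ) * poch b i))
  have hGeq : ∀ i, ∀ s ∈ Set.Ioi (0 : ℝ), G i s =
      (q ^ i / ((Nat.factorial i : ℝ) * poch b i)) *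
        (s ^ (a + i - 1) * Real.exp (-(c * s))) := fun i s hs => by
    have hs : 0 < s := hs
    simp only [G]
    rw [show a + i - 1 = a - 1 + i by ring, Real.rpow_add_natCast hs.ne', mul_pow]
    ring
  have hai : ∀ i : ℕ, 0 < a + i := fun i => by positivity
  have hGint : ∀ i, IntegrableOn (G i) (Set.Ioi 0) := fun i =>
    IntegrableOn.congr_fun ((integrableOn_rpow_mul_exp (hai i) hc).const_mul _)
      (fun s hs => (hGeq i s hs).symm) measurableSet_Ioi
  have hGval : ∀ i, ∫ s in Set.Ioi (0 : ℝ), G i s =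
      (1 / c) ^ a * Real.Gamma a * confluentTerm a b (q / c) i := fun i => by
    rw [setIntegral_congr_fun measurableSet_Ioi (hGeq i), integral_const_mul,
      Real.integral_rpow_mul_exp_neg_mul_Ioi (hai i) hc, Gamma_add_nat ha,
      Real.rpow_add_natCast (by positivity)]
    simp only [confluentTerm, poch, div_pow, one_pow]
    ring
  have hGnn : ∀ i, ∀ s ∈ Set.Ioi (0 : ℝ), 0 ≤ G i s := fun i s hs => by
    have hs : 0 < s := hs
    have := poch_pos hb i
    simp only [G]
    positivity
  have hnorm : ∀ i, ∫ s in Set.Ioi (0 : ℝ), ‖G i s‖ = ∫ s in Set.Ioi (0 : ℝ), G i s := fun i =>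
    setIntegral_congr_fun measurableSet_Ioi
      (fun s hs => Real.norm_of_nonneg (hGnn i s hs))
  have hsum : Summable fun i => ∫ s in Set.Ioi (0 : ℝ), ‖G i s‖ := by
    simp_rw [hnorm, hGval]
    exact (summable_confluentTerm a hb _).mul_left _
  have htsum : ∀ s, ∑' i, G i s = s ^ (a - 1) * Real.exp (-(c * s)) * limitF b (q * s) :=
    fun s => tsum_mul_left
  have hH := hasSum_integral_of_summable_integral_norm hGint hsum
  simp_rw [hGval, htsum] at hH
  have hval := hH.unique ((summable_confluentTerm a hb (q / c)).hasSum.mul_left _)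
  refine ⟨?_, hval⟩
  -- A non-integrable function has Bochner integral 0, so the positive value just found gives
  -- integrability.
  refine Integrable.of_integral_ne_zero ?_
  rw [hval]
  have := confluentF_pos ha hb (div_nonneg hq hc.le)
  have := Real.Gamma_pos_of_pos ha
  positivity

/-! ### The standard Gaussian measure and polar coordinates -/

lemma nontrivial_vec {p : ℕ} (hp : 1 ≤ p) : Nontrivial (Vec p) := by
  have : Nonempty (Fin p) := ⟨⟨0, hp⟩⟩
  infer_instance

/-- The density of the standard Gaussian measure. -/
def gaussianDensity (p : ℕ) (x : Vec p) : ℝ :=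
  (2 * Real.pi) ^ (-(p : ℝ) / 2) * Real.exp (-(‖x‖ ^ 2 / 2))

lemma gaussianDensity_nonneg (p : ℕ) (x : Vec p) : 0 ≤ gaussianDensity p x := by
  unfold gaussianDensity; positivity

@[fun_prop]
lemma measurable_gaussianDensity (p : ℕ) : Measurable (gaussianDensity p) := by
  unfold gaussianDensity; fun_prop

lemma integral_gaussianDensity (p : ℕ) : ∫ x, gaussianDensity p x = 1 := by
  have h := GaussianFourier.integral_rexp_neg_mul_sq_norm (V := Vec p) (b := 1 / 2) (by norm_num)
  have h2 : ∀ x : Vec p, Real.exp (-(‖x‖ ^ 2 / 2)) = Real.exp (-(1 / 2) * ‖x‖ ^ 2) := fun x => by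
    congr 1; ring
  simp only [gaussianDensity]
  rw [integral_const_mul]
  simp_rw [h2]
  rw [h, finrank_euclideanSpace_fin, show Real.pi / (1 / 2) = 2 * Real.pi by ring,
    ← Real.rpow_add (by positivity), show -(p : ℝ) / 2 + p / 2 = 0 by ring, Real.rpow_zero]

lemma integrable_gaussianDensity (p : ℕ) : Integrable (gaussianDensity p) :=
  Integrable.of_integral_ne_zero (by rw [integral_gaussianDensity]; exact one_ne_zero)

/-- Both sides are finite measures with the same characteristic function, by the Fourier transform
of a Gaussian. -/
lemma stdGaussian_eq_withDensity (p : ℕ) :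
    stdGaussian (Vec p) =
      (volume : Measure (Vec p)).withDensity fun x => ENNReal.ofReal (gaussianDensity p x) := by
  have hfin : IsFiniteMeasure ((volume : Measure (Vec p)).withDensity
      fun x => ENNReal.ofReal (gaussianDensity p x)) :=
    isFiniteMeasure_withDensity_ofReal (integrable_gaussianDensity p).2
  refine Measure.ext_of_charFun ?_
  ext t
  rw [charFun_stdGaussian, charFun_apply, integral_withDensity_eq_integral_toReal_smul
    (by fun_prop) (by simp)]
  have h := GaussianFourier.integral_cexp_neg_mul_sq_norm_add (V := Vec p) (b := 1 / 2)
    (by norm_num) Complex.I t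
  have h2 : ∀ x : Vec p, (ENNReal.ofReal (gaussianDensity p x)).toReal •
      Complex.exp (⟪x, t⟫ * Complex.I) = (((2 * Real.pi) ^ (-(p : ℝ) / 2) : ℝ) : ℂ) *
        Complex.exp (-(1 / 2) * (‖x‖ : ℂ) ^ 2 + Complex.I * ⟪t, x⟫) := fun x => by
    rw [ENNReal.toReal_ofReal (gaussianDensity_nonneg p x), gaussianDensity, Complex.real_smul,
      Complex.ofReal_mul, mul_assoc, Complex.ofReal_exp, ← Complex.exp_add, real_inner_comm]
    congr 2
    push_cast
    ring
  simp_rw [h2]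
  rw [integral_const_mul, h, finrank_euclideanSpace_fin, ← mul_assoc]
  have h3 : (((2 * Real.pi) ^ (-(p : ℝ) / 2) : ℝ) : ℂ) *
      ((Real.pi : ℂ) / (1 / 2)) ^ ((p : ℂ) / 2) = 1 := by
    have : ((Real.pi : ℂ) / (1 / 2)) ^ ((p : ℂ) / 2) =
        (((2 * Real.pi) ^ ((p : ℝ) / 2) : ℝ) : ℂ) := by
      rw [Complex.ofReal_cpow (by positivity)]
      push_cast
      congr 1
      ring
    rw [this, ← Complex.ofReal_mul, ← Real.rpow_add (by positivity),
      show -(p : ℝ) / 2 + p / 2 = 0 by ring, Real.rpow_zero, Complex.ofReal_one]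
  rw [h3, one_mul, Complex.I_sq]
  congr 1
  ring

lemma integral_stdGaussian_eq (p : ℕ) (f : Vec p → ℝ) :
    ∫ x, f x ∂stdGaussian (Vec p) = ∫ x, gaussianDensity p x * f x := by
  rw [stdGaussian_eq_withDensity, integral_withDensity_eq_integral_toReal_smul
    (by fun_prop) (by simp)]
  refine integral_congr_ae (ae_of_all _ fun x => ?_)
  simp [ENNReal.toReal_ofReal (gaussianDensity_nonneg p x)]

/-- The surface area of the unit sphere of `ℝ^p`. -/
def sphereArea (p : ℕ) : ENNReal := (volume : Measure (Vec p)).toSphere Set.univ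

lemma sphereArea_ne_zero {p : ℕ} (hp : 1 ≤ p) : sphereArea p ≠ 0 := by
  have := nontrivial_vec hp
  rw [sphereArea, Ne, Measure.measure_univ_eq_zero]
  exact Measure.toSphere_ne_zero _

lemma sphereArea_ne_top (p : ℕ) : sphereArea p ≠ ⊤ := measure_ne_top _ _

lemma isProbabilityMeasure_sphereUniform {p : ℕ} (hp : 1 ≤ p) :
    IsProbabilityMeasure (sphereUniform p) :=
  ⟨by
    rw [sphereUniform, Measure.smul_apply, smul_eq_mul]
    exact ENNReal.inv_mul_cancel (sphereArea_ne_zero hp) (sphereArea_ne_top p)⟩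

lemma toSphere_eq_smul {p : ℕ} (hp : 1 ≤ p) :
    (volume : Measure (Vec p)).toSphere = sphereArea p • sphereUniform p := by
  have : sphereUniform p = (sphereArea p)⁻¹ • (volume : Measure (Vec p)).toSphere := rfl
  rw [this, smul_smul, ENNReal.mul_inv_cancel (sphereArea_ne_zero hp) (sphereArea_ne_top p),
    one_smul]

/-- Integration in polar coordinates of a product of an angular and a radial function. -/
lemma integral_polar_mul {p : ℕ} (hp : 1 ≤ p) {F : Vec p → ℝ}
    (f : Metric.sphere (0 : Vec p) 1 → ℝ) (g : ℝ → ℝ)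
    (hF : ∀ (ω : Metric.sphere (0 : Vec p) 1) (r : ℝ), 0 < r →
      F (r • (ω : Vec p)) = f ω * g r) :
    ∫ x, F x = (sphereArea p).toReal * (∫ ω, f ω ∂sphereUniform p) *
      ∫ r in Set.Ioi (0 : ℝ), r ^ (p - 1) * g r := by
  have := nontrivial_vec hp
  calc ∫ x, F x = ∫ x : ({(0)}ᶜ : Set (Vec p)), F x.1 ∂((volume : Measure (Vec p)).comap (↑)) := by
        rw [integral_subtype_comap (measurableSet_singleton _).compl fun x => F x,
          restrict_compl_singleton]
    _ = ∫ z, F ((z.2 : ℝ) • (z.1 : Vec p)) ∂(volume : Measure (Vec p)).toSphere.prod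
          (.volumeIoiPow (Module.finrank ℝ (Vec p) - 1)) := by
        rw [← (volume : Measure (Vec p)).measurePreserving_homeomorphUnitSphereProd.integral_comp
          (Homeomorph.measurableEmbedding _)]
        refine integral_congr_ae (ae_of_all _ fun x => ?_)
        have hx : ‖(x : Vec p)‖ ≠ 0 := norm_ne_zero_iff.2 x.2
        simp [smul_smul, hx]
    _ = ∫ z, f z.1 * g (z.2 : ℝ) ∂(volume : Measure (Vec p)).toSphere.prod
          (.volumeIoiPow (Module.finrank ℝ (Vec p) - 1)) :=
        integral_congr_ae (ae_of_all _ fun z => hF z.1 z.2 z.2.2)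
    _ = (∫ ω, f ω ∂(volume : Measure (Vec p)).toSphere) *
          ∫ r : Set.Ioi (0 : ℝ), g r ∂(.volumeIoiPow (Module.finrank ℝ (Vec p) - 1)) :=
        integral_prod_mul f (fun r : Set.Ioi (0 : ℝ) => g r)
    _ = _ := by
        rw [toSphere_eq_smul hp, integral_smul_measure, smul_eq_mul]
        congr 1
        simp only [Measure.volumeIoiPow, ENNReal.ofReal, finrank_euclideanSpace_fin]
        rw [integral_withDensity_eq_integral_smul
            ((measurable_subtype_coe.pow_const _).real_toNNReal),
          integral_subtype_comap measurableSet_Ioi fun a => Real.toNNReal (a ^ (p - 1)) • g a]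
        refine setIntegral_congr_fun measurableSet_Ioi fun r hr => ?_
        have hr : 0 < r := hr
        simp only [NNReal.smul_def, smul_eq_mul]
        rw [Real.coe_toNNReal _ (by positivity)]

/-- Integration in polar coordinates of a nonnegative function. -/
lemma lintegral_polar {p : ℕ} (hp : 1 ≤ p) {F : Vec p → ENNReal} (hF : Measurable F) :
    ∫⁻ x, F x = sphereArea p * ∫⁻ r in Set.Ioi (0 : ℝ), ENNReal.ofReal (r ^ (p - 1)) *
      ∫⁻ ω, F (r • (ω : Vec p)) ∂sphereUniform p := by
  have := nontrivial_vec hp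
  have := isProbabilityMeasure_sphereUniform hp
  have hm : Measurable fun z : Metric.sphere (0 : Vec p) 1 × ℝ => F (z.2 • (z.1 : Vec p)) := by
    fun_prop
  have hm' : Measurable fun r : ℝ => ∫⁻ ω, F (r • (ω : Vec p)) ∂sphereUniform p :=
    hm.lintegral_prod_left'
  calc ∫⁻ x, F x = ∫⁻ x : ({(0)}ᶜ : Set (Vec p)), F x.1 ∂((volume : Measure (Vec p)).comap (↑)) := by
        rw [lintegral_subtype_comap (measurableSet_singleton _).compl fun x => F x,
          restrict_compl_singleton]
    _ = ∫⁻ z, F ((z.2 : ℝ) • (z.1 : Vec p)) ∂(volume : Measure (Vec p)).toSphere.prod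
          (.volumeIoiPow (Module.finrank ℝ (Vec p) - 1)) := by
        rw [← (volume : Measure (Vec p)).measurePreserving_homeomorphUnitSphereProd.lintegral_comp_emb
          (Homeomorph.measurableEmbedding _)]
        refine lintegral_congr fun x => ?_
        have hx : ‖(x : Vec p)‖ ≠ 0 := norm_ne_zero_iff.2 x.2
        simp [smul_smul, hx]
    _ = ∫⁻ r : Set.Ioi (0 : ℝ), ∫⁻ ω, F ((r : ℝ) • (ω : Vec p))
          ∂(volume : Measure (Vec p)).toSphere
          ∂(.volumeIoiPow (Module.finrank ℝ (Vec p) - 1)) :=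
        lintegral_prod_symm _ (by fun_prop)
    _ = ∫⁻ r : Set.Ioi (0 : ℝ), sphereArea p * ∫⁻ ω, F ((r : ℝ) • (ω : Vec p)) ∂sphereUniform p
          ∂(.volumeIoiPow (Module.finrank ℝ (Vec p) - 1)) := by
        rw [toSphere_eq_smul hp]
        simp_rw [lintegral_smul_measure, smul_eq_mul]
    _ = _ := by
        have hm'' : Measurable fun r : Set.Ioi (0 : ℝ) =>
            ∫⁻ ω, F ((r : ℝ) • (ω : Vec p)) ∂sphereUniform p := hm'.comp measurable_subtype_coe
        rw [lintegral_const_mul _ hm'']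
        congr 1
        simp only [Measure.volumeIoiPow, finrank_euclideanSpace_fin]
        rw [lintegral_withDensity_eq_lintegral_mul _ (by fun_prop) hm'']
        exact lintegral_subtype_comap measurableSet_Ioi
          (fun r => ENNReal.ofReal (r ^ (p - 1)) * ∫⁻ ω, F (r • (ω : Vec p)) ∂sphereUniform p)

/-! ### Spherical moments from Gaussian moments. -/

/-- The `n`-th moment of the norm of a standard Gaussian vector. -/
def radialMoment (p n : ℕ) : ℝ :=
  (2 * Real.pi) ^ (-(p : ℝ) / 2) * (sphereArea p).toReal *
    ∫ r in Set.Ioi (0 : ℝ), r ^ (p - 1) * (r ^ n * Real.exp (-(r ^ 2 / 2)))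

/-- Homogeneity separates angle and radius in polar coordinates. Spherical averages thereby inherit
what is known for the Gaussian: its isometry invariance and its one-dimensional marginals. -/
lemma integral_stdGaussian_of_homogeneous {p : ℕ} (hp : 1 ≤ p) {f : Vec p → ℝ} {n : ℕ}
    (hf : ∀ r : ℝ, 0 < r → ∀ x : Vec p, f (r • x) = r ^ n * f x) :
    ∫ x, f x ∂stdGaussian (Vec p) =
      (∫ ω, f (ω : Vec p) ∂sphereUniform p) * radialMoment p n := by
  have h := integral_polar_mul hp (F := fun x => gaussianDensity p x * f x)
    (fun ω => f (ω : Vec p))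
    (fun r => (2 * Real.pi) ^ (-(p : ℝ) / 2) * (r ^ n * Real.exp (-(r ^ 2 / 2))))
    (fun ω r hr => by
      have hω : ‖(ω : Vec p)‖ = 1 := by simp
      simp only [gaussianDensity, hf r hr, norm_smul, hω, mul_one, Real.norm_eq_abs, sq_abs]
      ring)
  rw [integral_stdGaussian_eq, h, radialMoment]
  simp_rw [mul_left_comm _ ((2 * Real.pi) ^ (-(p : ℝ) / 2)) _]
  rw [integral_const_mul]
  ring

lemma integral_rpow_mul_exp_neg_sq {s : ℝ} (hs : 0 < s) :
    ∫ r in Set.Ioi (0 : ℝ), r ^ (s - 1) * Real.exp (-(r ^ 2 / 2)) =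
      2 ^ (s / 2 - 1) * Real.Gamma (s / 2) := by
  have h := integral_rpow_mul_exp_neg_mul_rpow (p := 2) (q := s - 1) (b := 1 / 2) (by norm_num)
    (by linarith) (by norm_num)
  have h2 : ∀ r : ℝ, r ^ (s - 1) * Real.exp (-(r ^ 2 / 2)) =
      r ^ (s - 1) * Real.exp (-(1 / 2) * r ^ (2 : ℝ)) := fun r => by
    rw [Real.rpow_two]; congr 2; ring
  simp_rw [h2]
  rw [h, sub_add_cancel, one_div, Real.inv_rpow (by norm_num), ← Real.rpow_neg (by norm_num),
    Real.rpow_sub_one (by norm_num)]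
  rw [show -(-s / 2) = s / 2 by ring]
  ring

lemma radialMoment_eq {p : ℕ} (hp : 1 ≤ p) (n : ℕ) :
    radialMoment p n = (2 * Real.pi) ^ (-(p : ℝ) / 2) * (sphereArea p).toReal *
      (2 ^ (((p : ℝ) + n) / 2 - 1) * Real.Gamma (((p : ℝ) + n) / 2)) := by
  rw [radialMoment, ← integral_rpow_mul_exp_neg_sq (by positivity)]
  congr 1
  refine setIntegral_congr_fun measurableSet_Ioi fun r hr => ?_
  have hr : 0 < r := hr
  rw [← mul_assoc, ← pow_add, ← Real.rpow_natCast]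
  congr 2
  push_cast [Nat.cast_sub hp]
  ring

lemma radialMoment_zero {p : ℕ} (hp : 1 ≤ p) : radialMoment p 0 = 1 := by
  have := isProbabilityMeasure_sphereUniform hp
  have h := integral_stdGaussian_of_homogeneous hp (f := fun _ => (1 : ℝ)) (n := 0) (by simp)
  simpa using h.symm

lemma radialMoment_pos {p : ℕ} (hp : 1 ≤ p) (n : ℕ) : 0 < radialMoment p n := by
  have h1 : 0 < (sphereArea p).toReal :=
    ENNReal.toReal_pos (sphereArea_ne_zero hp) (sphereArea_ne_top p)
  have h2 : 0 < Real.Gamma (((p : ℝ) + n) / 2) := Real.Gamma_pos_of_pos (by positivity)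
  rw [radialMoment_eq hp]
  positivity

lemma radialMoment_even {p : ℕ} (hp : 1 ≤ p) (j : ℕ) :
    radialMoment p (2 * j) = 2 ^ j * poch ((p : ℝ) / 2) j := by
  have h0 := radialMoment_zero hp
  rw [radialMoment_eq hp] at h0 ⊢
  have hp2 : (0 : ℝ) < p / 2 := by positivity
  have e1 : ((p : ℝ) + (2 * j : ℕ)) / 2 = p / 2 + j := by push_cast; ring
  have e2 : ((p : ℝ) + (0 : ℕ)) / 2 = p / 2 := by push_cast; ring
  rw [e2] at h0
  rw [e1, Gamma_add_nat hp2, show (p : ℝ) / 2 + j - 1 = p / 2 - 1 + j by ring,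
    Real.rpow_add_natCast (by norm_num)]
  -- The total mass 1 in `h0` fixes the constant, so the area of the sphere never has to be
  -- computed.
  linear_combination (2 ^ j * poch ((p : ℝ) / 2) j) * h0

/-- The Gaussian is invariant under the isometry `e`, so its integral of `f` equals its own
negative; the radial moment is positive and can be divided out. -/
lemma integral_sphere_eq_zero_of_odd {p : ℕ} (hp : 1 ≤ p) {f : Vec p → ℝ} {n : ℕ}
    (hf : ∀ r : ℝ, 0 < r → ∀ x : Vec p, f (r • x) = r ^ n * f x) (e : Vec p ≃ₗᵢ[ℝ] Vec p)
    (he : ∀ x, f (e x) = -f x) : ∫ ω, f (ω : Vec p) ∂sphereUniform p = 0 := by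
  have h1 := integral_stdGaussian_of_homogeneous hp hf
  have h2 : ∫ x, f x ∂stdGaussian (Vec p) = ∫ x, f (e x) ∂stdGaussian (Vec p) := by
    have hmap : (stdGaussian (Vec p)).map e = stdGaussian (Vec p) := stdGaussian_map e
    conv_lhs => rw [← hmap]
    exact e.toHomeomorph.measurableEmbedding.integral_map f
  simp_rw [he] at h2
  rw [integral_neg] at h2
  have h3 : ∫ x, f x ∂stdGaussian (Vec p) = 0 := by linarith
  rw [h3] at h1
  exact (mul_eq_zero.1 h1.symm).resolve_right (radialMoment_pos hp n).ne'

lemma integral_pow_gaussianReal (j : ℕ) :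
    ∫ u, u ^ (2 * j) ∂gaussianReal 0 1 = 2 ^ j * poch (1 / 2) j := by
  rw [integral_gaussianReal_eq_integral_smul one_ne_zero]
  have h1 : ∀ u : ℝ, gaussianPDFReal 0 1 u • u ^ (2 * j) =
      (√(2 * Real.pi))⁻¹ * (|u| ^ (2 * j : ℕ) * Real.exp (-(|u| ^ 2 / 2))) := fun u => by
    rw [gaussianPDFReal, smul_eq_mul, pow_mul, pow_mul, sq_abs]
    simp only [sub_zero, NNReal.coe_one, mul_one, neg_div]
    ring
  simp_rw [h1]
  rw [integral_const_mul,
    integral_comp_abs (f := fun u => u ^ (2 * j : ℕ) * Real.exp (-(u ^ 2 / 2)))]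
  have h2 : ∫ r in Set.Ioi (0 : ℝ), r ^ (2 * j : ℕ) * Real.exp (-(r ^ 2 / 2)) =
      2 ^ ((1 : ℝ) / 2 + j - 1) * Real.Gamma (1 / 2 + j) := by
    rw [show (1 : ℝ) / 2 + j = (2 * j + 1) / 2 by ring, ← integral_rpow_mul_exp_neg_sq (by positivity)]
    refine setIntegral_congr_fun measurableSet_Ioi fun r hr => ?_
    rw [← Real.rpow_natCast]
    congr 2
    push_cast
    ring
  rw [h2, Gamma_add_nat (by norm_num), Real.Gamma_one_half_eq,
    show (1 : ℝ) / 2 + j - 1 = 1 / 2 + j - (1 : ℕ) by push_cast; ring,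
    Real.rpow_sub_natCast (by norm_num), Real.rpow_add_natCast (by norm_num),
    ← Real.sqrt_eq_rpow, Real.sqrt_mul (by norm_num)]
  have hpi : √Real.pi ≠ 0 := by positivity
  field_simp

/-- Equality of characteristic functions. Scaling a standard normal by ‖y‖ also covers y = 0. -/
lemma stdGaussian_map_inner {p : ℕ} (y : Vec p) :
    (stdGaussian (Vec p)).map (fun x => ⟪x, y⟫) = (gaussianReal 0 1).map (fun u => ‖y‖ * u) := by
  have : IsProbabilityMeasure ((stdGaussian (Vec p)).map (fun x => ⟪x, y⟫)) :=
    Measure.isProbabilityMeasure_map (by fun_prop)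
  have : IsProbabilityMeasure ((gaussianReal 0 1).map (fun u => ‖y‖ * u)) :=
    Measure.isProbabilityMeasure_map (by fun_prop)
  refine Measure.ext_of_charFun ?_
  ext t
  have h := charFun_stdGaussian (E := Vec p) (t • y)
  have h' := charFun_gaussianReal (μ := 0) (v := 1) (t := t * ‖y‖)
  rw [charFun_apply] at h
  rw [charFun_apply_real] at h'
  rw [charFun_apply_real, charFun_apply_real, integral_map (by fun_prop) (by fun_prop),
    integral_map (by fun_prop) (by fun_prop)]
  trans Complex.exp (-‖t • y‖ ^ 2 / 2)
  · rw [← h]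
    refine integral_congr_ae (ae_of_all _ fun x => ?_)
    simp [inner_smul_right]
  · rw [norm_smul]
    have e : Complex.exp (-((‖t‖ * ‖y‖ : ℝ) : ℂ) ^ 2 / 2) =
        ∫ x, Complex.exp (((t * ‖y‖ : ℝ) : ℂ) * x * Complex.I) ∂gaussianReal 0 1 := by
      rw [h']
      congr 1
      rw [← Complex.ofReal_pow, mul_pow, Real.norm_eq_abs, sq_abs]
      push_cast
      ring
    rw [e]
    refine integral_congr_ae (ae_of_all _ fun x => ?_)
    push_cast
    ring_nf

/-- The even moments of a linear functional on the unit sphere. -/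
lemma integral_sphere_inner_pow_even {p : ℕ} (hp : 1 ≤ p) (y : Vec p) (j : ℕ) :
    ∫ ω, ⟪(ω : Vec p), y⟫ ^ (2 * j) ∂sphereUniform p =
      ‖y‖ ^ (2 * j) * poch (1 / 2) j / poch ((p : ℝ) / 2) j := by
  have h := integral_stdGaussian_of_homogeneous hp (f := fun x => ⟪x, y⟫ ^ (2 * j)) (n := 2 * j)
    (fun r _ x => by rw [real_inner_smul_left, mul_pow])
  have h2 : ∫ x, ⟪x, y⟫ ^ (2 * j) ∂stdGaussian (Vec p) =
      ∫ u, u ^ (2 * j) ∂((stdGaussian (Vec p)).map (fun x => ⟪x, y⟫)) := by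
    rw [integral_map (by fun_prop) (by fun_prop)]
  rw [stdGaussian_map_inner, integral_map (by fun_prop) (by fun_prop)] at h2
  simp_rw [mul_pow] at h2
  rw [integral_const_mul, integral_pow_gaussianReal] at h2
  rw [h2, radialMoment_even hp] at h
  have hpp : 0 < poch ((p : ℝ) / 2) j := poch_pos (by positivity) j
  rw [eq_div_iff hpp.ne']
  have h22 : (2 : ℝ) ^ j ≠ 0 := by positivity
  apply mul_left_cancel₀ h22
  linear_combination -h

lemma integral_sphere_inner_pow_odd {p : ℕ} (hp : 1 ≤ p) (y : Vec p) (j : ℕ) :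
    ∫ ω, ⟪(ω : Vec p), y⟫ ^ (2 * j + 1) ∂sphereUniform p = 0 :=
  integral_sphere_eq_zero_of_odd hp (f := fun x => ⟪x, y⟫ ^ (2 * j + 1)) (n := 2 * j + 1)
    (fun r _ x => by rw [real_inner_smul_left, mul_pow]) (LinearIsometryEquiv.neg ℝ)
    (fun x => by simp [Odd.neg_pow (odd_two_mul_add_one j)])

/-! ### Exponential integrals over the sphere -/

lemma measurable_limitF {b : ℝ} (hb : 0 < b) : Measurable (limitF b) := by
  refine measurable_of_tendsto_metrizable
    (f := fun n z => ∑ i ∈ Finset.range n, z ^ i / ((Nat.factorial i : ℝ) * poch b i))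
    (fun n => ?_) ?_
  · exact Finset.measurable_sum _ (fun i _ => by fun_prop)
  · rw [tendsto_pi_nhds]
    exact fun z => (summable_limitF hb z).hasSum.tendsto_sum_nat

/-- Cancels the (1/2)_j of the spherical moments against the factorials of the exponential series,
which leaves the terms of `limitF`. -/
lemma factorial_two_mul_eq_poch (j : ℕ) :
    (Nat.factorial (2 * j) : ℝ) = 4 ^ j * (Nat.factorial j : ℝ) * poch (1 / 2) j := by
  induction j with
  | zero => simp [poch]
  | succ j ih =>
    rw [show 2 * (j + 1) = 2 * j + 1 + 1 by ring, Nat.factorial_succ, Nat.factorial_succ,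
      Nat.factorial_succ, poch_succ]
    push_cast
    rw [ih]
    ring

lemma integrable_sphere_of_continuous {p : ℕ} (hp : 1 ≤ p) {f : Vec p → ℝ} (hf : Continuous f) :
    Integrable (fun ω : Metric.sphere (0 : Vec p) 1 => f (ω : Vec p)) (sphereUniform p) := by
  have := isProbabilityMeasure_sphereUniform hp
  have hc : Continuous fun ω : Metric.sphere (0 : Vec p) 1 => f (ω : Vec p) :=
    hf.comp continuous_subtype_val
  exact hc.integrable_of_hasCompactSupport (HasCompactSupport.of_compactSpace _)

lemma abs_inner_sphere_le {p : ℕ} (ω : Metric.sphere (0 : Vec p) 1) (y : Vec p) :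
    |⟪(ω : Vec p), y⟫| ≤ ‖y‖ := by
  have h := abs_real_inner_le_norm (ω : Vec p) y
  simpa using h

/-- Termwise integration of `⟪ω, y⟫ ^ i * exp ⟪ω, y⟫` over the sphere. -/
lemma hasSum_integral_sphere_pow_mul_exp {p : ℕ} (hp : 1 ≤ p) (y : Vec p) (i : ℕ) :
    HasSum (fun n : ℕ => (∫ ω, ⟪(ω : Vec p), y⟫ ^ (n + i) ∂sphereUniform p) /
        (Nat.factorial n : ℝ))
      (∫ ω, ⟪(ω : Vec p), y⟫ ^ i * Real.exp ⟪(ω : Vec p), y⟫ ∂sphereUniform p) := by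
  have := isProbabilityMeasure_sphereUniform hp
  have hint : ∀ n : ℕ, Integrable (fun ω : Metric.sphere (0 : Vec p) 1 =>
      ⟪(ω : Vec p), y⟫ ^ (n + i) / (Nat.factorial n : ℝ)) (sphereUniform p) := fun n =>
    integrable_sphere_of_continuous hp (f := fun x => ⟪x, y⟫ ^ (n + i) / (Nat.factorial n : ℝ))
      (by fun_prop)
  -- |⟪ω, y⟫| ≤ ‖y‖ on the sphere, so the exponential series at ‖y‖ dominates.
  have hbound : ∀ n : ℕ, ∫ ω, ‖⟪((ω : Metric.sphere (0 : Vec p) 1) : Vec p), y⟫ ^ (n + i) /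
      (Nat.factorial n : ℝ)‖ ∂sphereUniform p ≤ ‖y‖ ^ i * (‖y‖ ^ n / (Nat.factorial n : ℝ)) := by
    intro n
    have h1 : ∀ ω : Metric.sphere (0 : Vec p) 1, ‖⟪(ω : Vec p), y⟫ ^ (n + i) /
        (Nat.factorial n : ℝ)‖ ≤ ‖y‖ ^ i * (‖y‖ ^ n / (Nat.factorial n : ℝ)) := fun ω => by
      rw [norm_div, norm_pow, Real.norm_eq_abs, RCLike.norm_natCast, ← mul_div_assoc, ← pow_add,
        add_comm i n]
      gcongr
      exact abs_inner_sphere_le ω y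
    have h2 := integral_mono (hint n).norm (integrable_const _) h1
    simpa using h2
  have hsum := hasSum_integral_of_summable_integral_norm hint
    (Summable.of_nonneg_of_le (fun n => integral_nonneg fun ω => norm_nonneg _) hbound
      ((Real.summable_pow_div_factorial ‖y‖).mul_left _))
  simp_rw [integral_div] at hsum
  convert! hsum using 2
  ext ω
  rw [Real.exp_eq_exp_ℝ, NormedSpace.exp_eq_tsum_div, ← tsum_mul_left]
  congr 1
  ext n
  rw [pow_add]
  ring

lemma integral_sphere_exp_inner {p : ℕ} (hp : 1 ≤ p) (y : Vec p) :
    ∫ ω, Real.exp ⟪(ω : Vec p), y⟫ ∂sphereUniform p = limitF ((p : ℝ) / 2) (‖y‖ ^ 2 / 4) := by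
  have h := hasSum_integral_sphere_pow_mul_exp hp y 0
  simp only [add_zero, pow_zero, one_mul] at h
  -- Odd moments vanish, so the sum is reindexed by n = 2j.
  rw [← (mul_right_injective₀ (two_ne_zero (α := ℕ))).hasSum_iff] at h
  · refine h.unique ?_
    convert! (summable_limitF (by positivity : 0 < (p : ℝ) / 2) (‖y‖ ^ 2 / 4)).hasSum using 2 with j
    simp only [Function.comp_apply]
    have h1 := (poch_pos (by norm_num : (0 : ℝ) < 1 / 2) j).ne'
    have h2 := (poch_pos (by positivity : 0 < (p : ℝ) / 2) j).ne'
    rw [integral_sphere_inner_pow_even hp, factorial_two_mul_eq_poch, pow_mul, div_pow]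
    field_simp
  · intro n hn
    obtain ⟨j, rfl⟩ : Odd n := by
      rw [← Nat.not_even_iff_odd]
      rintro ⟨j, rfl⟩
      exact hn ⟨j, by simp [two_mul]⟩
    rw [integral_sphere_inner_pow_odd hp, zero_div]

lemma integral_sphere_inner_mul_exp_self {p : ℕ} (hp : 1 ≤ p) (y : Vec p) :
    ∫ ω, ⟪(ω : Vec p), y⟫ * Real.exp ⟪(ω : Vec p), y⟫ ∂sphereUniform p =
      ‖y‖ ^ 2 / p * limitF ((p : ℝ) / 2 + 1) (‖y‖ ^ 2 / 4) := by
  have h := hasSum_integral_sphere_pow_mul_exp hp y 1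
  -- The extra factor ⟪ω, y⟫ makes n = 2j + 1 the surviving indices, with moments of order 2(j+1).
  simp only [pow_one] at h
  have hinj : Function.Injective fun j : ℕ => 2 * j + 1 := fun i j hij => by
    simp only at hij; omega
  rw [← hinj.hasSum_iff] at h
  · refine h.unique ?_
    convert! ((summable_limitF (by positivity : 0 < (p : ℝ) / 2 + 1)
      (‖y‖ ^ 2 / 4)).hasSum.mul_left (‖y‖ ^ 2 / p)) using 2 with j
    simp only [Function.comp_apply]
    have h1 := (poch_pos (by norm_num : (0 : ℝ) < 1 / 2) (j + 1)).ne'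
    have h2 := (poch_pos (by positivity : 0 < (p : ℝ) / 2 + 1) j).ne'
    have h3 : (0 : ℝ) < p := by exact_mod_cast hp
    have h4 := factorial_two_mul_eq_poch (j + 1)
    rw [show 2 * (j + 1) = 2 * j + 1 + 1 by ring, Nat.factorial_succ (2 * j + 1),
      Nat.factorial_succ j] at h4
    push_cast at h4
    have h6 : (0 : ℝ) < (Nat.factorial (2 * j + 1) : ℝ) := by positivity
    have h5 : (Nat.factorial (2 * j + 1) : ℝ) =
        4 ^ (j + 1) * (Nat.factorial j : ℝ) * poch (1 / 2) (j + 1) / 2 := by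
      have : (2 * (j : ℝ) + 1 + 1) ≠ 0 := by positivity
      apply mul_left_cancel₀ this
      linear_combination h4
    rw [show 2 * j + 1 + 1 = 2 * (j + 1) by ring, integral_sphere_inner_pow_even hp, h5, pow_mul,
      poch_succ_left ((p : ℝ) / 2), div_pow, pow_succ, pow_succ (4 : ℝ)]
    field_simp
    ring
  · intro n hn
    obtain ⟨j, rfl⟩ : Even n := by
      rw [← Nat.not_odd_iff_even]
      rintro ⟨j, rfl⟩
      exact hn ⟨j, rfl⟩
    rw [← two_mul, integral_sphere_inner_pow_odd hp, zero_div]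

/-- The reflection in the hyperplane orthogonal to d fixes y and flips the sign of ⟪·, d⟫. -/
lemma integral_sphere_inner_mul_exp_of_orthogonal {p : ℕ} (hp : 1 ≤ p) {y d : Vec p}
    (hd : ⟪d, y⟫ = 0) :
    ∫ ω, ⟪(ω : Vec p), d⟫ * Real.exp ⟪(ω : Vec p), y⟫ ∂sphereUniform p = 0 := by
  let e : Vec p ≃ₗᵢ[ℝ] Vec p := (ℝ ∙ d)ᗮ.reflection
  have hed : e d = -d := Submodule.reflection_orthogonalComplement_singleton_eq_neg d
  have hey : e y = y :=
    Submodule.reflection_mem_subspace_eq_self (Submodule.mem_orthogonal_singleton_iff_inner_right.2 hd)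
  have h1 : ∀ x, ⟪e x, d⟫ = -⟪x, d⟫ := fun x => by
    rw [← neg_neg ⟪e x, d⟫, ← inner_neg_right, ← hed, e.inner_map_map]
  have h2 : ∀ x, ⟪e x, y⟫ = ⟪x, y⟫ := fun x => by
    rw [← e.inner_map_map x y, hey]
  -- Dividing by ‖x‖ extends the integrand off the sphere as a function homogeneous of degree 0.
  have h := integral_sphere_eq_zero_of_odd hp (n := 0)
    (f := fun x => (‖x‖⁻¹ * ⟪x, d⟫) * Real.exp (‖x‖⁻¹ * ⟪x, y⟫))
    (fun r hr x => by
      have h3 : ∀ z : Vec p, ‖r • x‖⁻¹ * ⟪r • x, z⟫ = ‖x‖⁻¹ * ⟪x, z⟫ := fun z => by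
        rw [norm_smul, real_inner_smul_left, Real.norm_of_nonneg hr.le, mul_inv]
        field_simp
      rw [h3, h3, pow_zero, one_mul]) e
    (fun x => by rw [h1, h2, e.norm_map]; ring)
  simpa using h

/-- Split d into its projection α y and an orthogonal part; only the projection contributes. -/
lemma integral_sphere_inner_mul_exp {p : ℕ} (hp : 1 ≤ p) (y d : Vec p) :
    ∫ ω, ⟪(ω : Vec p), d⟫ * Real.exp ⟪(ω : Vec p), y⟫ ∂sphereUniform p =
      ⟪y, d⟫ / p * limitF ((p : ℝ) / 2 + 1) (‖y‖ ^ 2 / 4) := by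
  by_cases hy : y = 0
  · subst hy
    rw [integral_sphere_inner_mul_exp_of_orthogonal hp (inner_zero_right d)]
    simp
  have hn : ‖y‖ ^ 2 ≠ 0 := by simpa using hy
  set α : ℝ := ⟪y, d⟫ / ‖y‖ ^ 2 with hα
  have horth : ⟪d - α • y, y⟫ = 0 := by
    rw [inner_sub_left, real_inner_smul_left, real_inner_self_eq_norm_sq, hα,
      div_mul_cancel₀ _ hn, real_inner_comm, sub_self]
  have h1 : ∀ ω : Metric.sphere (0 : Vec p) 1, ⟪(ω : Vec p), d⟫ * Real.exp ⟪(ω : Vec p), y⟫ =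
      ⟪(ω : Vec p), d - α • y⟫ * Real.exp ⟪(ω : Vec p), y⟫ +
        α * (⟪(ω : Vec p), y⟫ * Real.exp ⟪(ω : Vec p), y⟫) := fun ω => by
    rw [inner_sub_right, inner_smul_right]; ring
  simp_rw [h1]
  rw [integral_add
      (integrable_sphere_of_continuous hp (f := fun x => ⟪x, d - α • y⟫ * Real.exp ⟪x, y⟫)
        (by fun_prop))
      (integrable_sphere_of_continuous hp (f := fun x => α * (⟪x, y⟫ * Real.exp ⟪x, y⟫))
        (by fun_prop)),
    integral_sphere_inner_mul_exp_of_orthogonal hp horth, integral_const_mul,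
    integral_sphere_inner_mul_exp_self hp, zero_add, hα]
  field_simp

/-- The average of `‖d - κ ω‖² exp ⟪ω, y⟫` over the unit sphere. -/
lemma lintegral_sphere_sq_mul_exp {p : ℕ} (hp : 1 ≤ p) (y d : Vec p) (κ : ℝ) :
    0 ≤ (‖d‖ ^ 2 + κ ^ 2) * limitF ((p : ℝ) / 2) (‖y‖ ^ 2 / 4) -
      2 * κ * (⟪y, d⟫ / p * limitF ((p : ℝ) / 2 + 1) (‖y‖ ^ 2 / 4)) ∧
    ∫⁻ ω, ENNReal.ofReal (‖d - κ • (ω : Vec p)‖ ^ 2 * Real.exp ⟪(ω : Vec p), y⟫) ∂sphereUniform p =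
      ENNReal.ofReal ((‖d‖ ^ 2 + κ ^ 2) * limitF ((p : ℝ) / 2) (‖y‖ ^ 2 / 4) -
        2 * κ * (⟪y, d⟫ / p * limitF ((p : ℝ) / 2 + 1) (‖y‖ ^ 2 / 4))) := by
  have h1 : ∀ ω : Metric.sphere (0 : Vec p) 1,
      ‖d - κ • (ω : Vec p)‖ ^ 2 * Real.exp ⟪(ω : Vec p), y⟫ =
        (‖d‖ ^ 2 + κ ^ 2) * Real.exp ⟪(ω : Vec p), y⟫ -
          2 * κ * (⟪(ω : Vec p), d⟫ * Real.exp ⟪(ω : Vec p), y⟫) := fun ω => by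
    have hω : ‖(ω : Vec p)‖ = 1 := by simp
    rw [norm_sub_sq_real, norm_smul, hω, inner_smul_right, mul_one, Real.norm_eq_abs, sq_abs,
      real_inner_comm]
    ring
  have hval : ∫ ω, ‖d - κ • ((ω : Metric.sphere (0 : Vec p) 1) : Vec p)‖ ^ 2 *
      Real.exp ⟪(ω : Vec p), y⟫ ∂sphereUniform p =
        (‖d‖ ^ 2 + κ ^ 2) * limitF ((p : ℝ) / 2) (‖y‖ ^ 2 / 4) -
        2 * κ * (⟪y, d⟫ / p * limitF ((p : ℝ) / 2 + 1) (‖y‖ ^ 2 / 4)) := by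
    simp_rw [h1]
    rw [integral_sub
      (integrable_sphere_of_continuous hp (f := fun x => (‖d‖ ^ 2 + κ ^ 2) * Real.exp ⟪x, y⟫)
        (by fun_prop))
      (integrable_sphere_of_continuous hp (f := fun x => 2 * κ * (⟪x, d⟫ * Real.exp ⟪x, y⟫))
        (by fun_prop)), integral_const_mul, integral_const_mul, integral_sphere_exp_inner hp,
        integral_sphere_inner_mul_exp hp]
  refine ⟨hval ▸ integral_nonneg fun ω => by positivity, ?_⟩
  rw [← hval, ofReal_integral_eq_lintegral_ofReal
    (integrable_sphere_of_continuous hp (f := fun x => ‖d - κ • x‖ ^ 2 * Real.exp ⟪x, y⟫)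
      (by fun_prop)) (ae_of_all _ fun ω => by positivity)]

/-- The Laplace transform of a combination of confluent limit series. -/
lemma lintegral_laplace_limitF {a b c q P Q R : ℝ} (ha : 0 < a) (hb : 0 < b) (hc : 0 < c)
    (hq : 0 ≤ q)
    (hnn : ∀ s, 0 < s → 0 ≤ (s * P + Q) * limitF b (q * s) - s * R * limitF (b + 1) (q * s)) :
    0 ≤ (1 / c) ^ (a + 1) * Real.Gamma (a + 1) *
        (P * confluentF (a + 1) b (q / c) - R * confluentF (a + 1) (b + 1) (q / c)) +
        Q * ((1 / c) ^ a * Real.Gamma a * confluentF a b (q / c)) ∧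
    ∫⁻ s in Set.Ioi (0 : ℝ), ENNReal.ofReal (s ^ (a - 1) * Real.exp (-(c * s)) *
        ((s * P + Q) * limitF b (q * s) - s * R * limitF (b + 1) (q * s))) =
      ENNReal.ofReal ((1 / c) ^ (a + 1) * Real.Gamma (a + 1) *
        (P * confluentF (a + 1) b (q / c) - R * confluentF (a + 1) (b + 1) (q / c)) +
        Q * ((1 / c) ^ a * Real.Gamma a * confluentF a b (q / c))) := by
  obtain ⟨i1, e1⟩ := laplace_limitF (b := b) (q := q) (by linarith : 0 < a + 1) hb hc hq
  obtain ⟨i2, e2⟩ := laplace_limitF (b := b + 1) (q := q) (by linarith : 0 < a + 1)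
    (by linarith) hc hq
  obtain ⟨i3, e3⟩ := laplace_limitF (b := b) (q := q) ha hb hc hq
  have hval := integral_add ((i1.const_mul P).sub (i2.const_mul R)) (i3.const_mul Q)
  have hint := ((i1.const_mul P).sub (i2.const_mul R)).add (i3.const_mul Q)
  simp only [Pi.sub_apply] at hval
  rw [integral_sub (i1.const_mul P) (i2.const_mul R), integral_const_mul, integral_const_mul,
    integral_const_mul, e1, e2, e3] at hval
  -- The factor s in front of P and R raises the gamma shape from a to a + 1; the Q term keeps shape
  -- a.
  have hpt : ∀ s ∈ Set.Ioi (0 : ℝ), P * (s ^ (a + 1 - 1) * Real.exp (-(c * s)) * limitF b (q * s)) -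
      R * (s ^ (a + 1 - 1) * Real.exp (-(c * s)) * limitF (b + 1) (q * s)) +
      Q * (s ^ (a - 1) * Real.exp (-(c * s)) * limitF b (q * s)) =
      s ^ (a - 1) * Real.exp (-(c * s)) *
        ((s * P + Q) * limitF b (q * s) - s * R * limitF (b + 1) (q * s)) := fun s hs => by
    have hs : 0 < s := hs
    rw [show a + 1 - 1 = a - 1 + 1 by ring, Real.rpow_add_one hs.ne']
    ring
  have hnn' : ∀ s ∈ Set.Ioi (0 : ℝ), 0 ≤ s ^ (a - 1) * Real.exp (-(c * s)) *
        ((s * P + Q) * limitF b (q * s) - s * R * limitF (b + 1) (q * s)) := fun s hs =>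
    have hs : 0 < s := hs
    mul_nonneg (by positivity) (hnn s hs)
  rw [setIntegral_congr_fun measurableSet_Ioi hpt] at hval
  have hform : ∀ x y z : ℝ, (1 / c) ^ (a + 1) * Real.Gamma (a + 1) * (P * x - R * y) + Q * z =
      P * ((1 / c) ^ (a + 1) * Real.Gamma (a + 1) * x) -
        R * ((1 / c) ^ (a + 1) * Real.Gamma (a + 1) * y) + Q * z := fun x y z => by ring
  rw [hform, ← hval]
  refine ⟨setIntegral_nonneg measurableSet_Ioi hnn', ?_⟩
  rw [ofReal_integral_eq_lintegral_ofReal]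
  · exact IntegrableOn.congr_fun hint hpt measurableSet_Ioi
  · exact (ae_restrict_iff' measurableSet_Ioi).2 (ae_of_all _ hnn')

/-! ### The risk of an equivariant estimator -/

section
open scoped MatrixOrder

lemma multivariateGaussian_scalar (p : ℕ) (θ : Vec p) {σ : ℝ} (hσ : 0 < σ) :
    multivariateGaussian θ (σ ^ 2 • (1 : Matrix (Fin p) (Fin p) ℝ)) =
      (stdGaussian (Vec p)).map (fun x => θ + σ • x) := by
  have hsq : CFC.sqrt (σ ^ 2 • (1 : Matrix (Fin p) (Fin p) ℝ)) =
      σ • (1 : Matrix (Fin p) (Fin p) ℝ) := by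
    refine CFC.sqrt_unique ?_ ?_
    · rw [smul_mul_smul_comm, mul_one, sq]
    · exact smul_nonneg hσ.le zero_le_one
  rw [multivariateGaussian, hsq]
  congr 1
  ext x
  simp

end

lemma isProbabilityMeasure_chiSquare {k : ℕ} (hk : 1 ≤ k) : IsProbabilityMeasure (chiSquare k) :=
  isProbabilityMeasure_gammaMeasure (by positivity) (by norm_num)

/-- The density of the chi-square distribution on the positive half-line. -/
def chiSquareDensity (k : ℕ) (y : ℝ) : ℝ :=
  (1 / 2) ^ ((k : ℝ) / 2) / Real.Gamma ((k : ℝ) / 2) * y ^ ((k : ℝ) / 2 - 1) *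
    Real.exp (-(1 / 2 * y))

lemma lintegral_chiSquare {k : ℕ} {g : ℝ → ENNReal} (hg : Measurable g) :
    ∫⁻ y, g y ∂chiSquare k =
      ∫⁻ y in Set.Ioi (0 : ℝ), ENNReal.ofReal (chiSquareDensity k y) * g y := by
  have hgm : Measurable (gammaPDF ((k : ℝ) / 2) (1 / 2)) :=
    (measurable_gammaPDFReal _ _).ennreal_ofReal
  rw [chiSquare, gammaMeasure, lintegral_withDensity_eq_lintegral_mul _
    hgm hg, ← lintegral_indicator measurableSet_Ioi]
  have h0 : ∀ᵐ y : ℝ, y ≠ 0 := by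
    simp [ae_iff, measure_singleton]
  refine lintegral_congr_ae ?_
  filter_upwards [h0] with y hy
  rcases lt_or_gt_of_ne hy with hy | hy
  · have : y ∉ Set.Ioi (0 : ℝ) := by simpa using hy.le
    rw [Set.indicator_of_notMem this]
    simp [gammaPDF_of_neg hy]
  · rw [Set.indicator_of_mem (Set.mem_Ioi.2 hy), Pi.mul_apply, gammaPDF_of_nonneg hy.le]
    rfl

/-- Substitute x = η + z; expanding ‖x − η‖² leaves the centred kernel tilted by exp ⟪x, η⟫. -/
lemma lintegral_stdGaussian_shift {p : ℕ} (η : Vec p) {G : Vec p → ENNReal} (hG : Measurable G) :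
    ∫⁻ z, G (η + z) ∂stdGaussian (Vec p) =
      ENNReal.ofReal ((2 * Real.pi) ^ (-(p : ℝ) / 2) * Real.exp (-(‖η‖ ^ 2 / 2))) *
        ∫⁻ x, ENNReal.ofReal (Real.exp (-(‖x‖ ^ 2 / 2)) * Real.exp ⟪x, η⟫) * G x := by
  rw [stdGaussian_eq_withDensity, lintegral_withDensity_eq_lintegral_mul _ (by fun_prop)
    (by fun_prop), ← lintegral_const_mul _ (by fun_prop)]
  conv_rhs => rw [← lintegral_add_left_eq_self _ η]
  refine lintegral_congr fun z => ?_
  rw [← mul_assoc, ← ENNReal.ofReal_mul (by positivity), Pi.mul_apply]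
  congr 2
  rw [gaussianDensity, mul_assoc, ← Real.exp_add, ← Real.exp_add]
  congr 2
  rw [norm_add_sq_real, inner_add_left, real_inner_self_eq_norm_sq, real_inner_comm]
  ring

/-- The substitution r = √(y t) replaces the radius by the ratio t = r²/y at fixed y. -/
lemma lintegral_pow_mul_comp_sq {p : ℕ} (hp : 1 ≤ p) {y : ℝ} (hy : 0 < y) (g : ℝ → ENNReal) :
    ∫⁻ r in Set.Ioi (0 : ℝ), ENNReal.ofReal (r ^ (p - 1)) * g (r ^ 2) =
      ∫⁻ t in Set.Ioi (0 : ℝ),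
        ENNReal.ofReal (1 / 2 * y ^ ((p : ℝ) / 2) * t ^ ((p : ℝ) / 2 - 1)) * g (y * t) := by
  have himg : (fun t : ℝ => √(y * t)) '' Set.Ioi 0 = Set.Ioi 0 := by
    ext r
    constructor
    · rintro ⟨t, ht, rfl⟩
      exact Real.sqrt_pos.2 (mul_pos hy ht)
    · intro hr
      have hr : 0 < r := hr
      refine ⟨r ^ 2 / y, div_pos (pow_pos hr 2) hy, ?_⟩
      dsimp only
      rw [mul_div_cancel₀ _ hy.ne', Real.sqrt_sq hr.le]
  have hder : ∀ t ∈ Set.Ioi (0 : ℝ), HasDerivWithinAt (fun t : ℝ => √(y * t))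
      (y / (2 * √(y * t))) (Set.Ioi 0) t := fun t ht => by
    have h := ((hasDerivAt_id t).const_mul y).sqrt (mul_pos hy ht).ne'
    simpa using h.hasDerivWithinAt
  have hinj : Set.InjOn (fun t : ℝ => √(y * t)) (Set.Ioi 0) := by
    intro s hs t ht hst
    have := (Real.sqrt_inj (mul_pos hy hs).le (mul_pos hy ht).le).1 hst
    exact mul_left_cancel₀ hy.ne' this
  conv_lhs => rw [← himg]
  rw [lintegral_image_eq_lintegral_abs_deriv_mul measurableSet_Ioi hder hinj]
  refine setLIntegral_congr_fun measurableSet_Ioi fun t ht => ?_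
  have ht : 0 < t := ht
  have hyt : 0 < y * t := mul_pos hy ht
  rw [Real.sq_sqrt hyt.le, ← mul_assoc, ← ENNReal.ofReal_mul (abs_nonneg _)]
  congr 2
  rw [abs_of_pos (by positivity), Real.sqrt_eq_rpow, ← Real.rpow_natCast, ← Real.rpow_mul hyt.le]
  have e1 : y / (2 * (y * t) ^ (1 / 2 : ℝ)) = y / 2 * (y * t) ^ (-(1 / 2) : ℝ) := by
    rw [Real.rpow_neg hyt.le]
    field_simp
  rw [e1, mul_assoc, ← Real.rpow_add hyt]
  have e2 : (-(1 / 2) : ℝ) + 1 / 2 * ((p - 1 : ℕ) : ℝ) = p / 2 - 1 := by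
    push_cast [Nat.cast_sub hp]
    ring
  rw [e2, Real.mul_rpow hy.le ht.le, Real.rpow_sub_one hy.ne']
  field_simp

/-- The angular average of `‖u X - c η‖²` against `exp ⟪X, η⟫`, where `‖X‖² = s`, `‖η‖ = lam`. -/
def angularForm (p : ℕ) (lam c u s : ℝ) : ℝ :=
  (u ^ 2 * s + c ^ 2 * lam ^ 2) * limitF ((p : ℝ) / 2) (s * lam ^ 2 / 4) -
    s * (2 * u * c * lam ^ 2 / p) * limitF ((p : ℝ) / 2 + 1) (s * lam ^ 2 / 4)

lemma lintegral_sphere_angularForm {p : ℕ} (hp : 1 ≤ p) (η : Vec p) (c u r : ℝ) :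
    0 ≤ angularForm p ‖η‖ c u (r ^ 2) ∧
    ∫⁻ ω, ENNReal.ofReal (Real.exp ⟪r • (ω : Vec p), η⟫ * ‖u • r • (ω : Vec p) - c • η‖ ^ 2)
      ∂sphereUniform p = ENNReal.ofReal (angularForm p ‖η‖ c u (r ^ 2)) := by
  -- Here c η plays the fixed decision and u r ω the moving point.
  have h := lintegral_sphere_sq_mul_exp hp (r • η) (c • η) (u * r)
  have e1 : ∀ ω : Metric.sphere (0 : Vec p) 1,
      Real.exp ⟪r • (ω : Vec p), η⟫ * ‖u • r • (ω : Vec p) - c • η‖ ^ 2 =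
      ‖c • η - (u * r) • (ω : Vec p)‖ ^ 2 * Real.exp ⟪(ω : Vec p), r • η⟫ := fun ω => by
    rw [norm_sub_rev, smul_smul, real_inner_smul_left, inner_smul_right]
    ring
  have e2 : (‖c • η‖ ^ 2 + (u * r) ^ 2) * limitF ((p : ℝ) / 2) (‖r • η‖ ^ 2 / 4) -
      2 * (u * r) * (⟪r • η, c • η⟫ / p * limitF ((p : ℝ) / 2 + 1) (‖r • η‖ ^ 2 / 4)) =
      angularForm p ‖η‖ c u (r ^ 2) := by
    have e3 : ‖r • η‖ ^ 2 / 4 = r ^ 2 * ‖η‖ ^ 2 / 4 := by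
      rw [norm_smul, mul_pow, Real.norm_eq_abs, sq_abs]
    rw [e3, norm_smul, mul_pow, Real.norm_eq_abs, sq_abs, real_inner_smul_left, inner_smul_right,
      real_inner_self_eq_norm_sq, angularForm]
    ring
  rw [e2] at h
  simp_rw [e1]
  exact h

lemma measurable_angularForm {p : ℕ} (hp : 1 ≤ p) (lam c : ℝ) :
    Measurable fun z : ℝ × ℝ => angularForm p lam c z.1 z.2 := by
  have h1 := measurable_limitF (by positivity : 0 < (p : ℝ) / 2)
  have h2 := measurable_limitF (by positivity : 0 < (p : ℝ) / 2 + 1)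
  unfold angularForm
  fun_prop

/-- For fixed y the multiplier is constant on each sphere ‖x‖ = r, so the angular average applies
with u = h(r²/y), and t = r²/y becomes the variable. -/
lemma lintegral_stdGaussian_multiplier {p : ℕ} (hp : 1 ≤ p) (η : Vec p) (c : ℝ) {h : ℝ → ℝ}
    (hh : Measurable h) {y : ℝ} (hy : 0 < y) :
    ∫⁻ z, ENNReal.ofReal (‖h (‖η + z‖ ^ 2 / y) • (η + z) - c • η‖ ^ 2) ∂stdGaussian (Vec p) =
      ENNReal.ofReal ((2 * Real.pi) ^ (-(p : ℝ) / 2) * Real.exp (-(‖η‖ ^ 2 / 2))) * sphereArea p *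
        ∫⁻ t in Set.Ioi (0 : ℝ), ENNReal.ofReal (1 / 2 * y ^ ((p : ℝ) / 2) * t ^ ((p : ℝ) / 2 - 1) *
          Real.exp (-(y * t / 2)) * angularForm p ‖η‖ c (h t) (y * t)) := by
  have hA := measurable_angularForm hp ‖η‖ c
  rw [lintegral_stdGaussian_shift η
    (G := fun x => ENNReal.ofReal (‖h (‖x‖ ^ 2 / y) • x - c • η‖ ^ 2)) (by fun_prop),
    lintegral_polar hp (by fun_prop), mul_assoc]
  congr 2
  have h1 : ∀ r ∈ Set.Ioi (0 : ℝ), ENNReal.ofReal (r ^ (p - 1)) *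
      ∫⁻ ω, ENNReal.ofReal (Real.exp (-(‖r • (ω : Vec p)‖ ^ 2 / 2)) *
          Real.exp ⟪r • (ω : Vec p), η⟫) *
        ENNReal.ofReal (‖h (‖r • (ω : Vec p)‖ ^ 2 / y) • r • (ω : Vec p) - c • η‖ ^ 2)
          ∂sphereUniform p =
      ENNReal.ofReal (r ^ (p - 1)) * (ENNReal.ofReal (Real.exp (-(r ^ 2 / 2))) *
        ENNReal.ofReal (angularForm p ‖η‖ c (h (r ^ 2 / y)) (r ^ 2))) := fun r hr => by
    congr 1
    rw [← (lintegral_sphere_angularForm hp η c (h (r ^ 2 / y)) r).2,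
      ← lintegral_const_mul _ (by fun_prop)]
    refine lintegral_congr fun ω => ?_
    have hω : ‖(ω : Vec p)‖ = 1 := by simp
    rw [norm_smul, hω, mul_one, Real.norm_eq_abs, sq_abs, ← ENNReal.ofReal_mul (by positivity),
      ← ENNReal.ofReal_mul (by positivity), mul_assoc]
  rw [setLIntegral_congr_fun measurableSet_Ioi h1,
    lintegral_pow_mul_comp_sq hp hy (fun s => ENNReal.ofReal (Real.exp (-(s / 2))) *
        ENNReal.ofReal (angularForm p ‖η‖ c (h (s / y)) s))]
  refine setLIntegral_congr_fun measurableSet_Ioi fun t ht => ?_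
  have ht : 0 < t := ht
  rw [mul_div_cancel_left₀ _ hy.ne', ← mul_assoc, ← ENNReal.ofReal_mul (by positivity),
    ← ENNReal.ofReal_mul (by positivity)]

/-- The normalizing constant of the density of the ratio statistic. -/
def riskConst (p k : ℕ) : ℝ :=
  (2 * Real.pi) ^ (-(p : ℝ) / 2) * (sphereArea p).toReal *
    ((1 / 2) * ((1 / 2) ^ ((k : ℝ) / 2) / Real.Gamma ((k : ℝ) / 2)))

lemma riskConst_pos {p k : ℕ} (hp : 1 ≤ p) (hk : 1 ≤ k) : 0 < riskConst p k := by
  have h1 : 0 < (sphereArea p).toReal :=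
    ENNReal.toReal_pos (sphereArea_ne_zero hp) (sphereArea_ne_top p)
  have h2 : 0 < Real.Gamma ((k : ℝ) / 2) := Real.Gamma_pos_of_pos (by positivity)
  unfold riskConst
  positivity

/-- The density of `T = ‖X‖² / S²` weighted by the conditional second moment of `‖X‖ / σ`, at
signal-to-noise ratio `lam`. -/
def riskWeight (p k : ℕ) (lam t : ℝ) : ℝ :=
  riskConst p k * Real.exp (-(lam ^ 2 / 2)) * t ^ ((p : ℝ) / 2) *
    ((1 / ((1 + t) / 2)) ^ (((k : ℝ) + p - 0) / 2 + 1) *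
      Real.Gamma (((k : ℝ) + p - 0) / 2 + 1)) *
    confluentF (((k : ℝ) + p - 0) / 2 + 1) ((p : ℝ) / 2) (lam ^ 2 * t / (2 * (1 + t)))

/-- The density of `T = ‖X‖² / S²` multiplied by `lam²`, the part of the risk that does not depend
on the estimator. -/
def riskBase (p k : ℕ) (lam t : ℝ) : ℝ :=
  riskConst p k * Real.exp (-(lam ^ 2 / 2)) * t ^ ((p : ℝ) / 2 - 1) * lam ^ 2 *
    ((1 / ((1 + t) / 2)) ^ (((k : ℝ) + p - 0) / 2) * Real.Gamma (((k : ℝ) + p - 0) / 2) *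
    confluentF (((k : ℝ) + p - 0) / 2) ((p : ℝ) / 2) (lam ^ 2 * t / (2 * (1 + t))))

lemma angularForm_nonneg {p : ℕ} (hp : 1 ≤ p) (η : Vec p) (c u : ℝ) {s : ℝ} (hs : 0 ≤ s) :
    0 ≤ angularForm p ‖η‖ c u s := by
  have := (lintegral_sphere_angularForm hp η c u √s).1
  rwa [Real.sq_sqrt hs] at this

lemma angularForm_mul (p : ℕ) (lam c u t y : ℝ) :
    angularForm p lam c u (y * t) =
      (y * (u ^ 2 * t) + c ^ 2 * lam ^ 2) * limitF ((p : ℝ) / 2) (t * lam ^ 2 / 4 * y) -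
        y * (2 * u * c * t * lam ^ 2 / p) *
          limitF ((p : ℝ) / 2 + 1) (t * lam ^ 2 / 4 * y) := by
  rw [angularForm, show y * t * lam ^ 2 / 4 = t * lam ^ 2 / 4 * y by ring]
  ring

/-- A gamma integral in y of rate (1+t)/2, which produces the argument λ²t/(2(1+t)) of F. The
multiplier `hBU` at radius λ = ‖η‖ appears as the ratio of the cross term to the second-moment term.
-/
lemma lintegral_angularForm {p k : ℕ} (hp : 1 ≤ p) (hk : 1 ≤ k) (η : Vec p) (c u : ℝ) {t : ℝ}
    (ht : 0 < t) :
    ENNReal.ofReal (riskConst p k * Real.exp (-(‖η‖ ^ 2 / 2)) * t ^ ((p : ℝ) / 2 - 1)) *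
      ∫⁻ y in Set.Ioi (0 : ℝ), ENNReal.ofReal (y ^ (((k : ℝ) + p - 0) / 2 - 1) *
        Real.exp (-((1 + t) / 2 * y)) * angularForm p ‖η‖ c u (y * t)) =
      ENNReal.ofReal (riskWeight p k ‖η‖ t *
        (u ^ 2 - 2 * c * u * hBU p k ‖η‖ 0 t) + c ^ 2 * riskBase p k ‖η‖ t) := by
  have hpR : (0 : ℝ) < p := by exact_mod_cast hp
  have hrc := riskConst_pos hp hk
  have ha : 0 < ((k : ℝ) + p - 0) / 2 := by rw [sub_zero]; positivity
  have hlap := (lintegral_laplace_limitF (b := (p : ℝ) / 2)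
    (c := (1 + t) / 2) (q := t * ‖η‖ ^ 2 / 4) (P := u ^ 2 * t) (Q := c ^ 2 * ‖η‖ ^ 2)
    (R := 2 * u * c * t * ‖η‖ ^ 2 / p) ha (by positivity)
    (by positivity) (by positivity) (fun s hs => by
      rw [← angularForm_mul]; exact angularForm_nonneg hp η c u (mul_pos hs ht).le)).2
  simp_rw [angularForm_mul]
  rw [hlap, ← ENNReal.ofReal_mul (by positivity)]
  congr 1
  have hz : t * ‖η‖ ^ 2 / 4 / ((1 + t) / 2) = ‖η‖ ^ 2 * t / (2 * (1 + t)) := by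
    field_simp
    ring
  have hF := (confluentF_pos (a := ((k : ℝ) + p - 0) / 2 + 1) (b := (p : ℝ) / 2)
    (z := ‖η‖ ^ 2 * t / (2 * (1 + t))) (by linarith) (by positivity) (by positivity)).ne'
  -- The `- 0` is the value l = 0, kept so that both sides show the same F terms as the unfolded
  -- `hBU`. Making these opaque leaves an identity of rational functions.
  rw [hz, riskWeight, riskBase, hBU]
  generalize confluentF (((k : ℝ) + p - 0) / 2 + 1) ((p : ℝ) / 2)
    (‖η‖ ^ 2 * t / (2 * (1 + t))) = F₁ at hF ⊢
  generalize confluentF (((k : ℝ) + p - 0) / 2 + 1) ((p : ℝ) / 2 + 1)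
    (‖η‖ ^ 2 * t / (2 * (1 + t))) = F₂
  generalize confluentF (((k : ℝ) + p - 0) / 2) ((p : ℝ) / 2)
    (‖η‖ ^ 2 * t / (2 * (1 + t))) = F₃
  generalize (1 / ((1 + t) / 2)) ^ (((k : ℝ) + p - 0) / 2 + 1) = v₁
  generalize (1 / ((1 + t) / 2)) ^ (((k : ℝ) + p - 0) / 2) = v₂
  generalize Real.Gamma (((k : ℝ) + p - 0) / 2 + 1) = v₃
  generalize Real.Gamma (((k : ℝ) + p - 0) / 2) = v₄
  generalize Real.exp (-(‖η‖ ^ 2 / 2)) = v₅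
  generalize ‖η‖ = lam
  have hpow : t ^ ((p : ℝ) / 2) = t ^ ((p : ℝ) / 2 - 1) * t := by
    rw [Real.rpow_sub_one ht.ne', div_mul_cancel₀ _ ht.ne']
  rw [hpow]
  generalize t ^ ((p : ℝ) / 2 - 1) = v₆
  field_simp

/-- The integrand of the risk in terms of `y = S² / σ²` and of the ratio `t = T`. -/
def riskKernel (p k : ℕ) (lam c : ℝ) (h : ℝ → ℝ) (y t : ℝ) : ENNReal :=
  ENNReal.ofReal (riskConst p k * Real.exp (-(lam ^ 2 / 2)) * t ^ ((p : ℝ) / 2 - 1)) *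
    ENNReal.ofReal (y ^ (((k : ℝ) + p - 0) / 2 - 1) * Real.exp (-((1 + t) / 2 * y)) *
      angularForm p lam c (h t) (y * t))

lemma measurable_riskKernel {p : ℕ} (hp : 1 ≤ p) (k : ℕ) (lam c : ℝ) {h : ℝ → ℝ}
    (hh : Measurable h) : Measurable (Function.uncurry (riskKernel p k lam c h)) := by
  have : Measurable fun z : ℝ × ℝ => angularForm p lam c (h z.2) (z.1 * z.2) :=
    (measurable_angularForm hp lam c).comp
      ((hh.comp measurable_snd).prodMk (measurable_fst.mul measurable_snd))
  unfold riskKernel Function.uncurry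
  fun_prop

lemma lintegral_stdGaussian_eq_riskKernel {p k : ℕ} (hp : 1 ≤ p) (hk : 1 ≤ k) (η : Vec p)
    (c : ℝ) {h : ℝ → ℝ} (hh : Measurable h) {y : ℝ} (hy : 0 < y) :
    ENNReal.ofReal (chiSquareDensity k y) *
      ∫⁻ z, ENNReal.ofReal (‖h (‖η + z‖ ^ 2 / y) • (η + z) - c • η‖ ^ 2) ∂stdGaussian (Vec p) =
      ∫⁻ t in Set.Ioi (0 : ℝ), riskKernel p k ‖η‖ c h y t := by
  have hrc := riskConst_pos hp hk
  have hGk : 0 < Real.Gamma ((k : ℝ) / 2) := Real.Gamma_pos_of_pos (by positivity)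
  have hconst : ENNReal.ofReal ((2 * Real.pi) ^ (-(p : ℝ) / 2) * Real.exp (-(‖η‖ ^ 2 / 2))) *
      sphereArea p = ENNReal.ofReal ((2 * Real.pi) ^ (-(p : ℝ) / 2) *
        Real.exp (-(‖η‖ ^ 2 / 2)) * (sphereArea p).toReal) := by
    rw [ENNReal.ofReal_mul (q := (sphereArea p).toReal) (by positivity),
      ENNReal.ofReal_toReal (sphereArea_ne_top p)]
  have hmA : Measurable fun t => angularForm p ‖η‖ c (h t) (y * t) :=
    (measurable_angularForm hp ‖η‖ c).comp (hh.prodMk (measurable_const.mul measurable_id))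
  rw [lintegral_stdGaussian_multiplier hp η c hh hy, hconst, ← mul_assoc,
    ← lintegral_const_mul _ (by fun_prop)]
  refine setLIntegral_congr_fun measurableSet_Ioi fun t ht => ?_
  have ht : 0 < t := ht
  have hd : 0 ≤ chiSquareDensity k y := by unfold chiSquareDensity; positivity
  rw [riskKernel, ← ENNReal.ofReal_mul hd, ← ENNReal.ofReal_mul (by positivity),
    ← ENNReal.ofReal_mul (by positivity)]
  congr 1
  -- The power y^(k/2−1) of the chi-square density meets the Jacobian y^(p/2), and e^(−y/2) meets
  -- e^(−yt/2).
  rw [chiSquareDensity, riskConst,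
    show ((k : ℝ) + p - 0) / 2 - 1 = (k / 2 - 1) + p / 2 by ring, Real.rpow_add hy,
    show -((1 + t) / 2 * y) = -(1 / 2 * y) + -(y * t / 2) by ring, Real.exp_add]
  generalize angularForm p ‖η‖ c (h t) (y * t) = v
  ring

lemma lintegral_riskKernel {p k : ℕ} (hp : 1 ≤ p) (hk : 1 ≤ k) (η : Vec p)
    (c : ℝ) (h : ℝ → ℝ) {t : ℝ} (ht : 0 < t) :
    ∫⁻ y in Set.Ioi (0 : ℝ), riskKernel p k ‖η‖ c h y t =
      ENNReal.ofReal (riskWeight p k ‖η‖ t *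
        (h t ^ 2 - 2 * c * h t * hBU p k ‖η‖ 0 t) + c ^ 2 * riskBase p k ‖η‖ t) := by
  have hmA : Measurable fun y => angularForm p ‖η‖ c (h t) (y * t) :=
    (measurable_angularForm hp ‖η‖ c).comp
      (measurable_const.prodMk (measurable_id.mul measurable_const))
  rw [← lintegral_angularForm hp hk η c (h t) ht, ← lintegral_const_mul _ (by fun_prop)]
  rfl

/-- Tonelli: swap the integrals and integrate y out first, since h depends on t alone. -/
lemma lintegral_chiSquare_stdGaussian_multiplier {p k : ℕ} (hp : 1 ≤ p) (hk : 1 ≤ k) (η : Vec p)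
    (c : ℝ) {h : ℝ → ℝ} (hh : Measurable h) :
    ∫⁻ y, ∫⁻ z, ENNReal.ofReal (‖h (‖η + z‖ ^ 2 / y) • (η + z) - c • η‖ ^ 2)
      ∂stdGaussian (Vec p) ∂chiSquare k =
      ∫⁻ t in Set.Ioi (0 : ℝ), ENNReal.ofReal (riskWeight p k ‖η‖ t *
        (h t ^ 2 - 2 * c * h t * hBU p k ‖η‖ 0 t) + c ^ 2 * riskBase p k ‖η‖ t) := by
  have hmeas : Measurable fun y : ℝ => ∫⁻ z, ENNReal.ofReal
      (‖h (‖η + z‖ ^ 2 / y) • (η + z) - c • η‖ ^ 2) ∂stdGaussian (Vec p) := by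
    have : Measurable fun q : ℝ × Vec p => ENNReal.ofReal
      (‖h (‖η + q.2‖ ^ 2 / q.1) • (η + q.2) - c • η‖ ^ 2) := by fun_prop
    exact this.lintegral_prod_right'
  calc _ = ∫⁻ y in Set.Ioi (0 : ℝ), ∫⁻ t in Set.Ioi (0 : ℝ), riskKernel p k ‖η‖ c h y t :=
        (lintegral_chiSquare hmeas).trans (setLIntegral_congr_fun measurableSet_Ioi fun y hy =>
          lintegral_stdGaussian_eq_riskKernel hp hk η c hh hy)
    _ = ∫⁻ t in Set.Ioi (0 : ℝ), ∫⁻ y in Set.Ioi (0 : ℝ), riskKernel p k ‖η‖ c h y t :=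
        lintegral_lintegral_swap (measurable_riskKernel hp k ‖η‖ c hh).aemeasurable
    _ = _ := setLIntegral_congr_fun measurableSet_Ioi fun t ht =>
        lintegral_riskKernel hp hk η c h ht

/-- The expected scaled squared distance of an equivariant estimator to `c θ`, as an integral over
the values of the maximal invariant `T`. -/
lemma lintegral_model_equivariant {p k : ℕ} (hp : 1 ≤ p) (hk : 1 ≤ k) (θ : Vec p) {σ : ℝ}
    (hσ : 0 < σ) (c : ℝ) {h : ℝ → ℝ} (hh : Measurable h) :
    ∫⁻ y, ENNReal.ofReal (‖equivariant h y - c • θ‖ ^ 2 / σ ^ 2) ∂model p k θ σ =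
      ∫⁻ t in Set.Ioi (0 : ℝ), ENNReal.ofReal (riskWeight p k (‖θ‖ / σ) t *
        (h t ^ 2 - 2 * c * h t * hBU p k (‖θ‖ / σ) 0 t) + c ^ 2 * riskBase p k (‖θ‖ / σ) t) := by
  have := isProbabilityMeasure_chiSquare hk
  have hnorm : ‖θ‖ / σ = ‖σ⁻¹ • θ‖ := by
    rw [norm_smul, norm_inv, Real.norm_of_nonneg hσ.le, div_eq_inv_mul]
  rw [hnorm, ← lintegral_chiSquare_stdGaussian_multiplier hp hk (σ⁻¹ • θ) c hh, model,
    multivariateGaussian_scalar p θ hσ, Measure.map_prod_map _ _ (by fun_prop) (by fun_prop),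
    lintegral_map (by unfold equivariant; fun_prop) (by fun_prop),
    lintegral_prod_symm _ (by unfold equivariant; fun_prop)]
  refine lintegral_congr fun y => lintegral_congr fun z => ?_
  congr 1
  -- T is unchanged when X is scaled by σ and S² by σ², so σ factors out and only η = θ/σ remains.
  have e : θ + σ • z = σ • (σ⁻¹ • θ + z) := by
    rw [smul_add, smul_smul, mul_inv_cancel₀ hσ.ne', one_smul]
  have e2 : c • θ = σ • (c • σ⁻¹ • θ) := by
    rw [smul_comm σ c, smul_smul σ, mul_inv_cancel₀ hσ.ne', one_smul]
  simp only [equivariant, Prod.map_apply]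
  rw [e, e2, norm_smul, mul_pow, Real.norm_eq_abs, sq_abs, mul_div_mul_left _ _ (by positivity),
    smul_comm _ σ, ← smul_sub, norm_smul, mul_pow, Real.norm_eq_abs, sq_abs,
    mul_div_cancel_left₀ _ (by positivity)]

/-- The case c = 1; the case c = 0, the second moment of the estimator, serves in
`risk_origin_lt_top`. -/
lemma risk_equivariant {p k : ℕ} (hp : 1 ≤ p) (hk : 1 ≤ k) (θ : Vec p) {σ : ℝ}
    (hσ : 0 < σ) {h : ℝ → ℝ} (hh : Measurable h) :
    risk p k θ σ (equivariant h) =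
      ∫⁻ t in Set.Ioi (0 : ℝ), ENNReal.ofReal (riskWeight p k (‖θ‖ / σ) t *
        (h t ^ 2 - 2 * h t * hBU p k (‖θ‖ / σ) 0 t) + riskBase p k (‖θ‖ / σ) t) := by
  simpa [risk, loss] using lintegral_model_equivariant hp hk θ hσ 1 hh

/-! ### The Bayes estimator for the boundary uniform prior -/

lemma measurable_loss {p : ℕ} (d : Vec p) :
    Measurable fun q : Vec p × ℝ => loss q.1 q.2 d := by
  unfold loss
  fun_prop

lemma measurable_likelihood (p k : ℕ) (x : Vec p) {w : ℝ} (hw : 0 < w) :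
    Measurable fun q : Vec p × ℝ => likelihood p k q.1 q.2 x w := by
  unfold likelihood gammaPDFReal
  simp only [if_pos hw.le]
  fun_prop

/-- Passing from the variance v to the precision s = 1/v makes the posterior kernel a gamma kernel.
-/
lemma lintegral_Ioi_comp_inv (g : ℝ → ENNReal) :
    ∫⁻ v in Set.Ioi (0 : ℝ), g v =
      ∫⁻ s in Set.Ioi (0 : ℝ), ENNReal.ofReal (s ^ 2)⁻¹ * g s⁻¹ := by
  have himg : (fun s : ℝ => s⁻¹) '' Set.Ioi 0 = Set.Ioi 0 := by
    ext v
    exact ⟨fun ⟨s, hs, hsv⟩ => hsv ▸ Set.mem_Ioi.2 (inv_pos.2 hs),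
      fun hv => ⟨v⁻¹, Set.mem_Ioi.2 (inv_pos.2 hv), inv_inv v⟩⟩
  conv_lhs => rw [← himg]
  rw [lintegral_image_eq_lintegral_abs_deriv_mul measurableSet_Ioi
    (fun s hs => (hasDerivAt_inv (ne_of_gt hs)).hasDerivWithinAt) inv_injective.injOn]
  refine setLIntegral_congr_fun measurableSet_Ioi fun s hs => ?_
  rw [abs_neg, abs_of_nonneg (by positivity)]

lemma lintegral_boundaryUniformPrior {p : ℕ} (hp : 1 ≤ p) (m l : ℝ) {G : Vec p × ℝ → ENNReal}
    (hG : Measurable G) :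
    ∫⁻ q, G q ∂boundaryUniformPrior p m l =
      ∫⁻ s in Set.Ioi (0 : ℝ), ENNReal.ofReal (s ^ 2)⁻¹ * (ENNReal.ofReal (s⁻¹ ^ (l / 2 - 1)) *
        ∫⁻ ω, G ((m * √s⁻¹) • (ω : Vec p), √s⁻¹) ∂sphereUniform p) := by
  have := isProbabilityMeasure_sphereUniform hp
  have hcomp : Measurable fun r : Metric.sphere (0 : Vec p) 1 × ℝ =>
      G ((m * √r.2) • (r.1 : Vec p), √r.2) := by fun_prop
  have hinner : Measurable fun v : ℝ =>
      ∫⁻ ω, G ((m * √v) • ((ω : Metric.sphere (0 : Vec p) 1) : Vec p), √v) ∂sphereUniform p :=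
    hcomp.lintegral_prod_left'
  rw [boundaryUniformPrior, lintegral_map hG (by fun_prop),
    lintegral_prod_symm _ hcomp.aemeasurable,
    lintegral_withDensity_eq_lintegral_mul _ (by fun_prop) hinner]
  exact lintegral_Ioi_comp_inv _

/-- The factor of the posterior expected loss that depends only on the observed scale. -/
def posteriorConst (p k : ℕ) (m w : ℝ) : ℝ :=
  (2 * Real.pi) ^ (-(p : ℝ) / 2) * Real.exp (-(m ^ 2 / 2)) *
    ((1 / 2) ^ ((k : ℝ) / 2) / Real.Gamma ((k : ℝ) / 2) * w ^ ((k : ℝ) / 2 - 1))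

lemma posteriorConst_pos {p k : ℕ} (hk : 1 ≤ k) (m : ℝ) {w : ℝ} (hw : 0 < w) :
    0 < posteriorConst p k m w := by
  have h2 : 0 < Real.Gamma ((k : ℝ) / 2) := Real.Gamma_pos_of_pos (by positivity)
  unfold posteriorConst
  positivity

/-- On the boundary ‖θ‖²/σ² = m² is constant, so its exponential goes into the constant and the
direction ω enters only through exp ⟪ω, m√s x⟫. -/
lemma likelihood_boundary (p k : ℕ) (m : ℝ) (x : Vec p) {w s : ℝ} (hw : 0 < w) (hs : 0 < s)
    (ω : Metric.sphere (0 : Vec p) 1) :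
    likelihood p k ((m * √s⁻¹) • (ω : Vec p)) √s⁻¹ x w =
      posteriorConst p k m w * (s ^ (((k : ℝ) + p - 0) / 2) *
        Real.exp (-((‖x‖ ^ 2 + w) / 2 * s))) * Real.exp ⟪(ω : Vec p), (m * √s) • x⟫ := by
  have hω : ‖(ω : Vec p)‖ = 1 := by simp
  have hsq : √s⁻¹ ^ 2 = s⁻¹ := Real.sq_sqrt (by positivity)
  have hss : √s⁻¹ * s = √s := by
    rw [Real.sqrt_inv, inv_mul_eq_div, Real.div_sqrt]
  have hexp : -‖x - (m * √s⁻¹) • (ω : Vec p)‖ ^ 2 / (2 * s⁻¹) =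
      -(m ^ 2 / 2) + -(‖x‖ ^ 2 / 2 * s) + ⟪(ω : Vec p), (m * √s) • x⟫ := by
    rw [norm_sub_sq_real, norm_smul, hω, inner_smul_right, inner_smul_right, mul_one,
      Real.norm_eq_abs, sq_abs, mul_pow, hsq, ← hss, real_inner_comm]
    field_simp
    ring
  rw [likelihood, gammaPDFReal, if_pos hw.le, hsq, hexp, Real.exp_add, Real.exp_add,
    show 1 / (2 * s⁻¹) = 1 / 2 * s by field_simp,
    Real.mul_rpow (by positivity) (by positivity), Real.mul_rpow (by norm_num) hs.le,
    Real.inv_rpow hs.le, neg_div, Real.rpow_neg hs.le, inv_inv, ← neg_div, posteriorConst,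
    show ((k : ℝ) + p - 0) / 2 = k / 2 + p / 2 by ring, Real.rpow_add hs,
    show -((‖x‖ ^ 2 + w) / 2 * s) = -(‖x‖ ^ 2 / 2 * s) + -(1 / 2 * s * w) by ring, Real.exp_add]
  ring

lemma sphere_form_scaled (p : ℕ) (m : ℝ) (x d : Vec p) {s : ℝ} (hs : 0 < s) :
    s * ((‖d‖ ^ 2 + (m * √s⁻¹) ^ 2) * limitF ((p : ℝ) / 2) (‖(m * √s) • x‖ ^ 2 / 4) -
      2 * (m * √s⁻¹) * (⟪(m * √s) • x, d⟫ / p *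
        limitF ((p : ℝ) / 2 + 1) (‖(m * √s) • x‖ ^ 2 / 4))) =
    (s * ‖d‖ ^ 2 + m ^ 2) * limitF ((p : ℝ) / 2) (m ^ 2 * ‖x‖ ^ 2 / 4 * s) -
      s * (2 * m ^ 2 * ⟪x, d⟫ / p) * limitF ((p : ℝ) / 2 + 1) (m ^ 2 * ‖x‖ ^ 2 / 4 * s) := by
  have hsq : √s ^ 2 = s := Real.sq_sqrt hs.le
  have hpos : √s ≠ 0 := (Real.sqrt_pos.2 hs).ne'
  have e : ‖(m * √s) • x‖ ^ 2 / 4 = m ^ 2 * ‖x‖ ^ 2 / 4 * s := by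
    rw [norm_smul, mul_pow, Real.norm_eq_abs, sq_abs, mul_pow, hsq]
    ring
  rw [e, real_inner_smul_left, Real.sqrt_inv, mul_pow, inv_pow, hsq]
  field_simp

lemma lintegral_sphere_posterior {p : ℕ} (hp : 1 ≤ p) {k : ℕ} (hk : 1 ≤ k) (m : ℝ) (x d : Vec p)
    {w s : ℝ} (hw : 0 < w) (hs : 0 < s) :
    ENNReal.ofReal (s ^ 2)⁻¹ * (ENNReal.ofReal (s⁻¹ ^ ((0 : ℝ) / 2 - 1)) *
      ∫⁻ ω, ENNReal.ofReal (likelihood p k ((m * √s⁻¹) • (ω : Vec p)) √s⁻¹ x w) *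
        loss ((m * √s⁻¹) • (ω : Vec p)) √s⁻¹ d ∂sphereUniform p) =
    ENNReal.ofReal (posteriorConst p k m w) *
      ENNReal.ofReal (s ^ (((k : ℝ) + p - 0) / 2 - 1) * Real.exp (-((‖x‖ ^ 2 + w) / 2 * s)) *
        ((s * ‖d‖ ^ 2 + m ^ 2) * limitF ((p : ℝ) / 2) (m ^ 2 * ‖x‖ ^ 2 / 4 * s) -
          s * (2 * m ^ 2 * ⟪x, d⟫ / p) *
            limitF ((p : ℝ) / 2 + 1) (m ^ 2 * ‖x‖ ^ 2 / 4 * s))) := by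
  have hC := posteriorConst_pos (p := p) hk m hw
  have hsq : √s⁻¹ ^ 2 = s⁻¹ := Real.sq_sqrt (by positivity)
  have hpt : ∀ ω : Metric.sphere (0 : Vec p) 1,
      ENNReal.ofReal (likelihood p k ((m * √s⁻¹) • (ω : Vec p)) √s⁻¹ x w) *
        loss ((m * √s⁻¹) • (ω : Vec p)) √s⁻¹ d =
      ENNReal.ofReal (posteriorConst p k m w * (s ^ (((k : ℝ) + p - 0) / 2) *
        Real.exp (-((‖x‖ ^ 2 + w) / 2 * s))) * s) *
      ENNReal.ofReal (‖d - (m * √s⁻¹) • (ω : Vec p)‖ ^ 2 *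
        Real.exp ⟪(ω : Vec p), (m * √s) • x⟫) := fun ω => by
    rw [likelihood_boundary p k m x hw hs, loss, hsq, ← ENNReal.ofReal_mul (by positivity),
      ← ENNReal.ofReal_mul (by positivity), div_inv_eq_mul]
    congr 1
    ring
  simp_rw [hpt]
  rw [lintegral_const_mul _ (by fun_prop), (lintegral_sphere_sq_mul_exp hp _ _ _).2,
    ← sphere_form_scaled p m x d hs, ← ENNReal.ofReal_mul (by positivity),
    ← ENNReal.ofReal_mul (by positivity), ← ENNReal.ofReal_mul (by positivity),
    ← ENNReal.ofReal_mul hC.le]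
  congr 1
  -- Powers of s: −2 from the Jacobian, 1 from the prior, (k+p)/2 from the likelihood, 1 from the
  -- loss. One of them is absorbed by `sphere_form_scaled`, leaving (k+p)/2 − 1.
  have e1 : s⁻¹ ^ ((0 : ℝ) / 2 - 1) = s := by
    rw [zero_div, zero_sub, Real.rpow_neg_one, inv_inv]
  rw [e1, Real.rpow_sub_one hs.ne']
  field_simp

/-- The posterior expected loss for the boundary uniform prior as a quadratic function of the
decision. -/
lemma posteriorLoss_boundaryUniformPrior {p k : ℕ} (hp : 1 ≤ p) (hk : 1 ≤ k) (m : ℝ) (x : Vec p)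
    {w : ℝ} (hw : 0 < w) :
    ∃ A B : ℝ, 0 < A ∧ ∀ d : Vec p,
      0 ≤ A * (‖d‖ ^ 2 - 2 * hBU p k m 0 (‖x‖ ^ 2 / w) * ⟪x, d⟫) + B ∧
      posteriorLoss p k (boundaryUniformPrior p m 0) x w d =
        ENNReal.ofReal (A * (‖d‖ ^ 2 - 2 * hBU p k m 0 (‖x‖ ^ 2 / w) * ⟪x, d⟫) + B) := by
  have := isProbabilityMeasure_sphereUniform hp
  have hpR : (0 : ℝ) < p := by exact_mod_cast hp
  have hC := posteriorConst_pos (p := p) hk m hw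
  have ha : 0 < ((k : ℝ) + p - 0) / 2 := by rw [sub_zero]; positivity
  have hc : 0 < (‖x‖ ^ 2 + w) / 2 := by positivity
  -- The same argument of F as in the risk, with t = ‖x‖²/w and λ = m.
  have hz : m ^ 2 * ‖x‖ ^ 2 / 4 / ((‖x‖ ^ 2 + w) / 2) =
      m ^ 2 * (‖x‖ ^ 2 / w) / (2 * (1 + ‖x‖ ^ 2 / w)) := by
    field_simp
    ring
  have hz0 : 0 ≤ m ^ 2 * (‖x‖ ^ 2 / w) / (2 * (1 + ‖x‖ ^ 2 / w)) := by positivity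
  have hF := confluentF_pos (a := ((k : ℝ) + p - 0) / 2 + 1) (b := (p : ℝ) / 2) (by linarith)
    (by positivity) hz0
  have hG := Real.Gamma_pos_of_pos (by linarith : 0 < ((k : ℝ) + p - 0) / 2 + 1)
  refine ⟨posteriorConst p k m w * ((1 / ((‖x‖ ^ 2 + w) / 2)) ^ (((k : ℝ) + p - 0) / 2 + 1) *
      Real.Gamma (((k : ℝ) + p - 0) / 2 + 1) *
      confluentF (((k : ℝ) + p - 0) / 2 + 1) ((p : ℝ) / 2)
        (m ^ 2 * (‖x‖ ^ 2 / w) / (2 * (1 + ‖x‖ ^ 2 / w)))),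
    posteriorConst p k m w * (m ^ 2 * ((1 / ((‖x‖ ^ 2 + w) / 2)) ^ (((k : ℝ) + p - 0) / 2) *
      Real.Gamma (((k : ℝ) + p - 0) / 2) *
      confluentF (((k : ℝ) + p - 0) / 2) ((p : ℝ) / 2)
        (m ^ 2 * (‖x‖ ^ 2 / w) / (2 * (1 + ‖x‖ ^ 2 / w))))), by positivity, fun d => ?_⟩
  obtain ⟨hnn, hlap⟩ := lintegral_laplace_limitF (b := (p : ℝ) / 2) (q := m ^ 2 * ‖x‖ ^ 2 / 4)
    (P := ‖d‖ ^ 2) (Q := m ^ 2) (R := 2 * m ^ 2 * ⟪x, d⟫ / p) ha (by positivity) hc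
    (by positivity) (fun s hs => by
      rw [← sphere_form_scaled p m x d hs]
      exact mul_nonneg hs.le (lintegral_sphere_sq_mul_exp hp _ _ _).1)
  rw [hz] at hnn hlap
  have h1 := measurable_limitF (by positivity : 0 < (p : ℝ) / 2)
  have h2 := measurable_limitF (by positivity : 0 < (p : ℝ) / 2 + 1)
  have hl := measurable_loss d
  have hlik := measurable_likelihood p k x hw
  have hint : Measurable fun q : Vec p × ℝ =>
      ENNReal.ofReal (likelihood p k q.1 q.2 x w) * loss q.1 q.2 d :=
    hlik.ennreal_ofReal.mul hl
  have hpost : posteriorLoss p k (boundaryUniformPrior p m 0) x w d =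
      ENNReal.ofReal (posteriorConst p k m w) *
        ENNReal.ofReal ((1 / ((‖x‖ ^ 2 + w) / 2)) ^ (((k : ℝ) + p - 0) / 2 + 1) *
          Real.Gamma (((k : ℝ) + p - 0) / 2 + 1) *
          (‖d‖ ^ 2 * confluentF (((k : ℝ) + p - 0) / 2 + 1) ((p : ℝ) / 2)
            (m ^ 2 * (‖x‖ ^ 2 / w) / (2 * (1 + ‖x‖ ^ 2 / w))) -
          2 * m ^ 2 * ⟪x, d⟫ / p * confluentF (((k : ℝ) + p - 0) / 2 + 1) ((p : ℝ) / 2 + 1)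
            (m ^ 2 * (‖x‖ ^ 2 / w) / (2 * (1 + ‖x‖ ^ 2 / w)))) +
          m ^ 2 * ((1 / ((‖x‖ ^ 2 + w) / 2)) ^ (((k : ℝ) + p - 0) / 2) *
            Real.Gamma (((k : ℝ) + p - 0) / 2) *
            confluentF (((k : ℝ) + p - 0) / 2) ((p : ℝ) / 2)
              (m ^ 2 * (‖x‖ ^ 2 / w) / (2 * (1 + ‖x‖ ^ 2 / w))))) := by
    rw [posteriorLoss, lintegral_boundaryUniformPrior hp m 0 hint, ← hlap,
      ← lintegral_const_mul _ (by fun_prop)]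
    exact setLIntegral_congr_fun measurableSet_Ioi fun s hs =>
      lintegral_sphere_posterior hp hk m x d hw hs
  rw [← ENNReal.ofReal_mul hC.le] at hpost
  have hval : ∀ v₁ v₂ F₁ F₂ F₃ : ℝ, F₁ ≠ 0 →
      posteriorConst p k m w * (v₁ * F₁) * (‖d‖ ^ 2 - 2 * (m ^ 2 / p * (F₂ / F₁)) * ⟪x, d⟫) +
        posteriorConst p k m w * (m ^ 2 * (v₂ * F₃)) =
      posteriorConst p k m w * (v₁ * (‖d‖ ^ 2 * F₁ - 2 * m ^ 2 * ⟪x, d⟫ / p * F₂) +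
        m ^ 2 * (v₂ * F₃)) := by
    intro v₁ v₂ F₁ F₂ F₃ hF₁
    field_simp
  rw [hBU, hval _ _ _ _ _ hF.ne', hpost]
  exact ⟨mul_nonneg hC.le hnn, rfl⟩

/-- Complete the square in the posterior loss: its excess over the minimum is A ‖d − b x‖². -/
lemma isBayes_boundaryUniformPrior {p k : ℕ} (hp : 1 ≤ p) (hk : 1 ≤ k) (m : ℝ) :
    IsBayes p k (boundaryUniformPrior p m 0) (equivariant (hBU p k m 0)) := by
  intro x w hw d hd
  obtain ⟨A, B, hA, hAB⟩ := posteriorLoss_boundaryUniformPrior hp hk m x hw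
  simp only [equivariant] at hd ⊢
  set b := hBU p k m 0 (‖x‖ ^ 2 / w)
  rw [(hAB _).2, (hAB d).2, ENNReal.ofReal_lt_ofReal_iff_of_nonneg (hAB _).1]
  have h1 : 0 < ‖d - b • x‖ ^ 2 := by
    have : 0 < ‖d - b • x‖ := norm_pos_iff.2 (sub_ne_zero.2 hd)
    positivity
  rw [norm_sub_sq_real, norm_smul, inner_smul_right, mul_pow, Real.norm_eq_abs, sq_abs,
    real_inner_comm] at h1
  have h2 : ‖b • x‖ ^ 2 - 2 * b * ⟪x, b • x⟫ < ‖d‖ ^ 2 - 2 * b * ⟪x, d⟫ := by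
    rw [norm_smul, inner_smul_right, mul_pow, Real.norm_eq_abs, sq_abs,
      real_inner_self_eq_norm_sq]
    linarith
  have := mul_lt_mul_of_pos_left h2 hA
  linarith

/-! ### Dominance -/

lemma hBU_zero_radius (p k : ℕ) (l t : ℝ) : hBU p k 0 l t = 0 := by simp [hBU]

lemma hBU_pos {p k : ℕ} (hp : 1 ≤ p) {m t : ℝ} (hm : 0 < m) (ht : 0 < t) :
    0 < hBU p k m 0 t := by
  have hpR : (0 : ℝ) < p := by exact_mod_cast hp
  have ha : 0 < ((k : ℝ) + p - 0) / 2 + 1 := by rw [sub_zero]; positivity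
  have h1 := confluentF_pos ha (by positivity : 0 < (p : ℝ) / 2 + 1)
    (by positivity : 0 ≤ m ^ 2 * t / (2 * (1 + t)))
  have h2 := confluentF_pos ha (by positivity : 0 < (p : ℝ) / 2)
    (by positivity : 0 ≤ m ^ 2 * t / (2 * (1 + t)))
  unfold hBU
  positivity

/-- Up to the positive factor 2(1+t)/(tp), free of the radius, this is z F(a, b+1, z)/F(a, b, z) at
a point z that grows with the radius. -/
lemma hBU_mono {p k : ℕ} (hp : 1 ≤ p) {lam m t : ℝ} (hlam : 0 ≤ lam) (hlm : lam ≤ m)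
    (ht : 0 < t) : hBU p k lam 0 t ≤ hBU p k m 0 t := by
  have hpR : (0 : ℝ) < p := by exact_mod_cast hp
  have ha : 1 ≤ ((k : ℝ) + p - 0) / 2 + 1 := by
    rw [sub_zero]
    have : 0 ≤ ((k : ℝ) + p) / 2 := by positivity
    linarith
  have hz : 0 ≤ lam ^ 2 * t / (2 * (1 + t)) := by positivity
  have hzz : lam ^ 2 * t / (2 * (1 + t)) ≤ m ^ 2 * t / (2 * (1 + t)) := by gcongr
  have h := confluentF_ratio_mono ha (by positivity : 0 < (p : ℝ) / 2) hz hzz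
  have e : ∀ μ : ℝ, hBU p k μ 0 t = 2 * (1 + t) / (t * p) * (μ ^ 2 * t / (2 * (1 + t)) *
      (confluentF (((k : ℝ) + p - 0) / 2 + 1) ((p : ℝ) / 2 + 1) (μ ^ 2 * t / (2 * (1 + t))) /
        confluentF (((k : ℝ) + p - 0) / 2 + 1) ((p : ℝ) / 2) (μ ^ 2 * t / (2 * (1 + t))))) := by
    intro μ
    rw [hBU, ← mul_assoc]
    congr 1
    field_simp
  rw [e, e]
  exact mul_le_mul_of_nonneg_left h (by positivity)

lemma measurable_hBU {p : ℕ} (hp : 1 ≤ p) (k : ℕ) (m l : ℝ) : Measurable (hBU p k m l) := by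
  have h1 := measurable_confluentF (((k : ℝ) + p - l) / 2 + 1)
    (by positivity : 0 < (p : ℝ) / 2 + 1)
  have h2 := measurable_confluentF (((k : ℝ) + p - l) / 2 + 1)
    (by positivity : 0 < (p : ℝ) / 2)
  unfold hBU
  fun_prop

lemma measurable_riskWeight {p : ℕ} (hp : 1 ≤ p) (k : ℕ) (lam : ℝ) :
    Measurable (riskWeight p k lam) := by
  have h1 := measurable_confluentF (((k : ℝ) + p - 0) / 2 + 1)
    (by positivity : 0 < (p : ℝ) / 2)
  unfold riskWeight
  fun_prop

lemma riskWeight_pos {p k : ℕ} (hp : 1 ≤ p) (hk : 1 ≤ k) (lam : ℝ) {t : ℝ} (ht : 0 < t) :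
    0 < riskWeight p k lam t := by
  have ha : 0 < ((k : ℝ) + p - 0) / 2 + 1 := by rw [sub_zero]; positivity
  have h0 := riskConst_pos hp hk
  have h1 := confluentF_pos ha (by positivity : 0 < (p : ℝ) / 2)
    (by positivity : 0 ≤ lam ^ 2 * t / (2 * (1 + t)))
  have h2 := Real.Gamma_pos_of_pos ha
  unfold riskWeight
  positivity

/-- Apart from exp(−λ²/2), the weight depends on λ only through a factor F ≥ 1, which equals 1 at λ
= 0. -/
lemma riskWeight_zero_le {p k : ℕ} (hp : 1 ≤ p) (hk : 1 ≤ k) (lam : ℝ) {t : ℝ} (ht : 0 < t) :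
    riskWeight p k 0 t ≤ Real.exp (lam ^ 2 / 2) * riskWeight p k lam t := by
  have ha : 0 < ((k : ℝ) + p - 0) / 2 + 1 := by rw [sub_zero]; positivity
  have h0 := riskConst_pos hp hk
  have h1 := one_le_confluentF ha (by positivity : 0 < (p : ℝ) / 2)
    (by positivity : 0 ≤ lam ^ 2 * t / (2 * (1 + t)))
  have h2 := Real.Gamma_pos_of_pos ha
  have e0 : riskWeight p k 0 t = riskConst p k * t ^ ((p : ℝ) / 2) *
      ((1 / ((1 + t) / 2)) ^ (((k : ℝ) + p - 0) / 2 + 1) *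
        Real.Gamma (((k : ℝ) + p - 0) / 2 + 1)) := by
    simp [riskWeight, confluentF_zero]
  have e1 : Real.exp (lam ^ 2 / 2) * riskWeight p k lam t = riskWeight p k 0 t *
      confluentF (((k : ℝ) + p - 0) / 2 + 1) ((p : ℝ) / 2) (lam ^ 2 * t / (2 * (1 + t))) := by
    have hexp : Real.exp (lam ^ 2 / 2) * Real.exp (-(lam ^ 2 / 2)) = 1 := by
      rw [← Real.exp_add, add_neg_cancel, Real.exp_zero]
    rw [e0, riskWeight]
    linear_combination (riskConst p k * t ^ ((p : ℝ) / 2) *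
      ((1 / ((1 + t) / 2)) ^ (((k : ℝ) + p - 0) / 2 + 1) *
        Real.Gamma (((k : ℝ) + p - 0) / 2 + 1)) *
      confluentF (((k : ℝ) + p - 0) / 2 + 1) ((p : ℝ) / 2) (lam ^ 2 * t / (2 * (1 + t)))) * hexp
  rw [e1]
  exact le_mul_of_one_le_right (riskWeight_pos hp hk 0 ht).le h1

lemma isProbabilityMeasure_model {p k : ℕ} (hk : 1 ≤ k) (θ : Vec p) (σ : ℝ) :
    IsProbabilityMeasure (model p k θ σ) := by
  have := isProbabilityMeasure_chiSquare hk
  have : IsProbabilityMeasure ((chiSquare k).map (fun y => σ ^ 2 * y)) :=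
    Measure.isProbabilityMeasure_map (by fun_prop)
  unfold model
  infer_instance

lemma measurable_equivariant {p : ℕ} {h : ℝ → ℝ} (hh : Measurable h) :
    Measurable (equivariant h : Estimator p) := by
  unfold equivariant
  fun_prop

lemma risk_origin {p k : ℕ} (hp : 1 ≤ p) (hk : 1 ≤ k) {h : ℝ → ℝ} (hh : Measurable h) :
    risk p k 0 1 (equivariant h) =
      ∫⁻ t in Set.Ioi (0 : ℝ), ENNReal.ofReal (riskWeight p k 0 t * h t ^ 2) := by
  rw [risk_equivariant hp hk 0 one_pos hh]
  simp [hBU_zero_radius, riskBase]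

lemma mem_paramSpace_origin (p : ℕ) {m : ℝ} (hm : 0 < m) :
    ((0 : Vec p), (1 : ℝ)) ∈ paramSpace p m := by
  simp [paramSpace, hm.le]

/-- If the risk of an equivariant estimator is finite somewhere, then it is finite at the origin. -/
lemma risk_origin_lt_top {p k : ℕ} (hp : 1 ≤ p) (hk : 1 ≤ k) {h : ℝ → ℝ} (hh : Measurable h)
    {θ : Vec p} {σ : ℝ} (hσ : 0 < σ) (hfin : risk p k θ σ (equivariant h) < ⊤) :
    risk p k 0 1 (equivariant h) < ⊤ := by
  have := isProbabilityMeasure_model (p := p) hk θ σ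
  -- ‖δ‖² ≤ 2‖δ − θ‖² + 2‖θ‖² bounds the scaled second moment of the estimator by its risk plus a
  -- constant.
  have hpt : ∀ y : Vec p × ℝ, ENNReal.ofReal (‖equivariant h y - (0 : ℝ) • θ‖ ^ 2 / σ ^ 2) ≤
      ENNReal.ofReal 2 * loss θ σ (equivariant h y) + ENNReal.ofReal (2 * (‖θ‖ ^ 2 / σ ^ 2)) := fun y => by
    rw [loss, ← ENNReal.ofReal_mul (by norm_num),
      ← ENNReal.ofReal_add (by positivity) (by positivity)]
    refine ENNReal.ofReal_le_ofReal ?_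
    rw [← mul_add, ← add_div, ← mul_div_assoc]
    gcongr
    have h1 : ‖equivariant h y - (0 : ℝ) • θ‖ ≤ ‖equivariant h y - θ‖ + ‖θ‖ := by
      rw [zero_smul, sub_zero]
      simpa using norm_add_le (equivariant h y - θ) θ
    have h2 := pow_le_pow_left₀ (norm_nonneg _) h1 2
    nlinarith [sq_nonneg (‖equivariant h y - θ‖ - ‖θ‖)]
  have h2 : ∫⁻ y, ENNReal.ofReal (‖equivariant h y - (0 : ℝ) • θ‖ ^ 2 / σ ^ 2) ∂model p k θ σ
      < ⊤ := by
    refine (lintegral_mono hpt).trans_lt ?_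
    rw [lintegral_add_right _ measurable_const, lintegral_const_mul' _ _ ENNReal.ofReal_ne_top,
      lintegral_const, measure_univ, mul_one]
    exact ENNReal.add_lt_top.2 ⟨ENNReal.mul_lt_top ENNReal.ofReal_lt_top hfin, ENNReal.ofReal_lt_top⟩
  rw [lintegral_model_equivariant hp hk θ hσ 0 hh] at h2
  rw [risk_origin hp hk hh]
  calc ∫⁻ t in Set.Ioi (0 : ℝ), ENNReal.ofReal (riskWeight p k 0 t * h t ^ 2)
      ≤ ∫⁻ t in Set.Ioi (0 : ℝ), ENNReal.ofReal (Real.exp ((‖θ‖ / σ) ^ 2 / 2)) *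
          ENNReal.ofReal (riskWeight p k (‖θ‖ / σ) t *
            (h t ^ 2 - 2 * 0 * h t * hBU p k (‖θ‖ / σ) 0 t) +
            0 ^ 2 * riskBase p k (‖θ‖ / σ) t) := by
        refine setLIntegral_mono' measurableSet_Ioi fun t ht => ?_
        rw [← ENNReal.ofReal_mul (Real.exp_pos _).le]
        refine ENNReal.ofReal_le_ofReal ?_
        have := mul_le_mul_of_nonneg_right (riskWeight_zero_le hp hk (‖θ‖ / σ) ht)
          (sq_nonneg (h t))
        linarith
    _ < ⊤ := by
        rw [lintegral_const_mul' _ _ ENNReal.ofReal_ne_top]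
        exact ENNReal.mul_lt_top ENNReal.ofReal_lt_top h2

/-- The pointwise gain is (h₁ − h₂)(h₁ + h₂ − 2g) with g the best multiplier at ‖θ‖/σ, itself at
most the one at m. Asking for the midpoint bound only where the multipliers differ lets the lemma
serve truncations and piecewise modifications. -/
lemma risk_equivariant_le {p k : ℕ} (hp : 1 ≤ p) (hk : 1 ≤ k) {m : ℝ} {h₁ h₂ : ℝ → ℝ}
    (hh₁ : Measurable h₁) (hh₂ : Measurable h₂) (hle : ∀ t, 0 < t → h₂ t ≤ h₁ t)
    (hmid : ∀ t, 0 < t → h₂ t ≠ h₁ t → hBU p k m 0 t ≤ (h₂ t + h₁ t) / 2)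
    {q : Vec p × ℝ} (hq : q ∈ paramSpace p m) :
    risk p k q.1 q.2 (equivariant h₂) ≤ risk p k q.1 q.2 (equivariant h₁) := by
  obtain ⟨hσ, hqm⟩ := hq
  rw [risk_equivariant hp hk q.1 hσ hh₁, risk_equivariant hp hk q.1 hσ hh₂]
  refine setLIntegral_mono' measurableSet_Ioi fun t ht => ENNReal.ofReal_le_ofReal ?_
  by_cases heq : h₂ t = h₁ t
  · rw [heq]
  have hw := riskWeight_pos hp hk (‖q.1‖ / q.2) ht
  have h1 := hBU_mono (k := k) hp (div_nonneg (norm_nonneg q.1) hσ.le) hqm ht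
  have h2 := hmid t ht heq
  have h3 := mul_nonneg (sub_nonneg.2 (hle t ht))
    (by linarith : 0 ≤ h₁ t + h₂ t - 2 * hBU p k (‖q.1‖ / q.2) 0 t)
  have h4 : h₂ t ^ 2 - 2 * h₂ t * hBU p k (‖q.1‖ / q.2) 0 t ≤
      h₁ t ^ 2 - 2 * h₁ t * hBU p k (‖q.1‖ / q.2) 0 t := by linarith
  have := mul_le_mul_of_nonneg_left h4 hw.le
  linarith

/-- Strictness is seen at the origin, where the integrand is a weight times the squared multiplier
and the midpoint bound forces h₂² < h₁² wherever h₂ ≠ h₁. -/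
lemma dominates_equivariant {p k : ℕ} (hp : 1 ≤ p) (hk : 1 ≤ k) {m : ℝ} (hm : 0 < m)
    {h₁ h₂ : ℝ → ℝ} (hh₁ : Measurable h₁) (hh₂ : Measurable h₂)
    (hle : ∀ t, 0 < t → h₂ t ≤ h₁ t)
    (hmid : ∀ t, 0 < t → h₂ t ≠ h₁ t → hBU p k m 0 t ≤ (h₂ t + h₁ t) / 2)
    (hne : 0 < volume {t : ℝ | 0 < t ∧ h₂ t ≠ h₁ t})
    (hfin : HasFiniteRisk p k m (equivariant h₂)) :
    Dominates p k m (equivariant h₂) (equivariant h₁) := by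
  refine ⟨fun q hq => risk_equivariant_le hp hk hh₁ hh₂ hle hmid hq,
    (0, 1), mem_paramSpace_origin p hm, ?_⟩
  obtain ⟨q, hq, hqf⟩ := hfin
  have hfin0 := risk_origin_lt_top hp hk hh₂ hq.1 hqf
  have hstrict : ∀ t, 0 < t → h₂ t ≠ h₁ t →
      riskWeight p k 0 t * h₂ t ^ 2 < riskWeight p k 0 t * h₁ t ^ 2 := fun t ht hnet => by
    have h1 : h₂ t < h₁ t := lt_of_le_of_ne (hle t ht) hnet
    have h2 := hmid t ht hnet
    have h3 := hBU_pos (k := k) hp hm ht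
    refine mul_lt_mul_of_pos_left ?_ (riskWeight_pos hp hk 0 ht)
    have := mul_pos (sub_pos.2 h1) (by linarith : 0 < h₁ t + h₂ t)
    linarith
  have hmw := measurable_riskWeight hp k 0
  dsimp only
  rw [risk_origin hp hk hh₂] at hfin0
  rw [risk_origin hp hk hh₂, risk_origin hp hk hh₁]
  refine lintegral_strict_mono_of_ae_le_of_ae_lt_on (by fun_prop) hfin0.ne ?_
    (s := {t : ℝ | 0 < t ∧ h₂ t ≠ h₁ t}) ?_ ?_
  · refine (ae_restrict_iff' measurableSet_Ioi).2 (ae_of_all _ fun t ht => ?_)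
    refine ENNReal.ofReal_le_ofReal ?_
    by_cases heq : h₂ t = h₁ t
    · rw [heq]
    · exact (hstrict t ht heq).le
  · rw [Measure.restrict_eq_self _ (fun t ht => ht.1)]
    exact hne.ne'
  · refine ae_of_all _ fun t ht => ?_
    have h0 := mul_nonneg (riskWeight_pos hp hk 0 ht.1).le (sq_nonneg (h₂ t))
    exact (ENNReal.ofReal_lt_ofReal_iff_of_nonneg h0).2 (hstrict t ht.1 ht.2)

lemma risk_zero_lt_top {p k : ℕ} (hk : 1 ≤ k) (θ : Vec p) (σ : ℝ) :
    risk p k θ σ (fun _ => 0) < ⊤ := by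
  have := isProbabilityMeasure_model (p := p) hk θ σ
  rw [risk, lintegral_const, measure_univ, mul_one]
  exact ENNReal.ofReal_lt_top

lemma equivariant_zero (p : ℕ) : (equivariant (fun _ => 0) : Estimator p) = fun _ => 0 := by
  funext y
  simp [equivariant]

lemma dominates_min_hBU {p k : ℕ} (hp : 1 ≤ p) (hk : 1 ≤ k) {m : ℝ} (hm : 0 < m)
    {h₁ : ℝ → ℝ} (hh₁ : Measurable h₁)
    (hvol : 0 < volume {t : ℝ | 0 < t ∧ hBU p k m 0 t < h₁ t})
    (hfin : HasFiniteRisk p k m (equivariant (fun t => min (h₁ t) (hBU p k m 0 t)))) :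
    Dominates p k m (equivariant (fun t => min (h₁ t) (hBU p k m 0 t))) (equivariant h₁) := by
  refine dominates_equivariant hp hk hm hh₁ (hh₁.min (measurable_hBU hp k m 0))
    (fun t _ => min_le_left _ _) (fun t _ hne => ?_)
    (hvol.trans_le (measure_mono fun t ht => ⟨ht.1, ?_⟩)) hfin
  · have h1 : hBU p k m 0 t < h₁ t := by
      by_contra! hcon
      exact hne (min_eq_left hcon)
    rw [min_eq_right h1.le]
    linarith
  · rw [min_eq_right ht.2.le]
    exact ht.2.ne

/-- If `equivariant h₁` has finite risk somewhere, so does its truncation, which then dominates it.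
Otherwise its risk is ∞ throughout, and the zero estimator, of finite risk, dominates it. -/
lemma inadmissible_of_hBU_lt {p k : ℕ} (hp : 1 ≤ p) (hk : 1 ≤ k) {m : ℝ} (hm : 0 < m)
    {h₁ : ℝ → ℝ} (hh₁ : Measurable h₁)
    (hvol : 0 < volume {t : ℝ | 0 < t ∧ hBU p k m 0 t < h₁ t}) :
    Inadmissible p k m (equivariant h₁) := by
  have hmin : Measurable fun t => min (h₁ t) (hBU p k m 0 t) := hh₁.min (measurable_hBU hp k m 0)
  by_cases hfin : HasFiniteRisk p k m (equivariant h₁)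
  · refine ⟨_, measurable_equivariant hmin, dominates_min_hBU hp hk hm hh₁ hvol ?_⟩
    obtain ⟨q, hq, hqf⟩ := hfin
    refine ⟨q, hq, (risk_equivariant_le hp hk hh₁ hmin (fun t _ => min_le_left _ _)
      (fun t _ hne => ?_) hq).trans_lt hqf⟩
    have h1 : hBU p k m 0 t < h₁ t := by
      by_contra! hcon
      exact hne (min_eq_left hcon)
    rw [min_eq_right h1.le]
    linarith
  · have htop : ∀ q ∈ paramSpace p m, risk p k q.1 q.2 (equivariant h₁) = ⊤ := fun q hq => by
      by_contra hcon
      exact hfin ⟨q, hq, lt_top_iff_ne_top.2 hcon⟩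
    refine ⟨fun _ => 0, measurable_const, fun q hq => ?_, (0, 1), mem_paramSpace_origin p hm, ?_⟩
    · rw [htop q hq]
      exact le_top
    · rw [htop _ (mem_paramSpace_origin p hm)]
      exact risk_zero_lt_top hk _ _

/-- When ‖θ‖/σ = m exactly, this multiplier minimizes the risk integrand pointwise, so it does no
worse than the zero estimator. -/
lemma hasFiniteRisk_hBU {p k : ℕ} (hp : 1 ≤ p) (hk : 1 ≤ k) {m : ℝ} (hm : 0 < m) :
    HasFiniteRisk p k m (equivariant (hBU p k m 0)) := by
  have hh := measurable_hBU hp k m 0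
  have := nontrivial_vec hp
  obtain ⟨θ, hθ⟩ := NormedSpace.exists_lt_norm ℝ (Vec p) 0
  let θ' : Vec p := (m / ‖θ‖) • θ
  have hn : ‖θ'‖ / 1 = m := by
    rw [div_one, norm_smul, Real.norm_of_nonneg (by positivity), div_mul_cancel₀ _ hθ.ne']
  refine ⟨(θ', 1), ⟨one_pos, hn.le⟩, lt_of_le_of_lt ?_ (risk_zero_lt_top hk θ' 1)⟩
  rw [← equivariant_zero p, risk_equivariant hp hk θ' one_pos hh,
    risk_equivariant hp hk θ' one_pos measurable_const, hn]
  refine setLIntegral_mono' measurableSet_Ioi fun t ht => ENNReal.ofReal_le_ofReal ?_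
  have hw := riskWeight_pos hp hk m ht
  nlinarith [mul_nonneg hw.le (sq_nonneg (hBU p k m 0 t))]

end

end BoundedSNR

open BoundedSNR in
theorem theorem3p2 (p k : ℕ) (hp : 1 ≤ p) (hk : 1 ≤ k) (m : ℝ) (hm : 0 < m) :
    -- (a)
    (∀ h₁ h₂ : ℝ → ℝ, Measurable h₁ → Measurable h₂ →
      (∀ t, 0 < t → h₂ t ≤ h₁ t) →
      (∀ t, 0 < t → hBU p k m 0 t ≤ (h₂ t + h₁ t) / 2) →
      0 < volume {t : ℝ | 0 < t ∧ h₂ t ≠ h₁ t} →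
      HasFiniteRisk p k m (equivariant h₂) →
      Dominates p k m (equivariant h₂) (equivariant h₁)) ∧
    -- (b)
    (∀ (h₁ : ℝ → ℝ) (U : Set ℝ), Measurable h₁ → MeasurableSet U →
      U ⊆ {t : ℝ | 0 < t ∧ hBU p k m 0 t < h₁ t} → 0 < volume U →
      Inadmissible p k m (equivariant h₁) ∧
      (HasFiniteRisk p k m (equivariant (fun t => min (h₁ t) (hBU p k m 0 t))) →
        Dominates p k m (equivariant (fun t => min (h₁ t) (hBU p k m 0 t))) (equivariant h₁)) ∧
      (∀ h h' : ℝ → ℝ, Measurable h' →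
        (∀ t ∈ U, 2 * hBU p k m 0 t - h₁ t ≤ h' t ∧ h' t ≤ h₁ t) →
        (∀ t ∈ U, h t = h' t) → (∀ t ∉ U, h t = h₁ t) →
        0 < volume {t : ℝ | t ∈ U ∧ h' t ≠ h₁ t} →
        HasFiniteRisk p k m (equivariant h) →
        Dominates p k m (equivariant h) (equivariant h₁))) ∧
    -- (c)
    (IsBayes p k (boundaryUniformPrior p m 0) (equivariant (hBU p k m 0)) ∧
      ∀ h₁ : ℝ → ℝ, Measurable h₁ →
        (∀ t, 0 < t → hBU p k m 0 t ≤ h₁ t) →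
        0 < volume {t : ℝ | 0 < t ∧ h₁ t ≠ hBU p k m 0 t} →
        Dominates p k m (equivariant (hBU p k m 0)) (equivariant h₁)) := by
  refine ⟨fun h₁ h₂ hh₁ hh₂ hle hmid hne hfin => ?_, fun h₁ U hh₁ hU hsub hvol => ⟨?_, ?_, ?_⟩,
    isBayes_boundaryUniformPrior hp hk m, fun h₁ hh₁ hle hne => ?_⟩
  · exact dominates_equivariant hp hk hm hh₁ hh₂ hle (fun t ht _ => hmid t ht) hne hfin
  · exact inadmissible_of_hBU_lt hp hk hm hh₁ (hvol.trans_le (measure_mono hsub))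
  · exact dominates_min_hBU hp hk hm hh₁ (hvol.trans_le (measure_mono hsub))
  · intro h h' hh' hb hin hout hne hfin
    classical
    -- Measurability of h is not assumed; it follows from this piecewise form.
    have hpw : h = U.piecewise h' h₁ := by
      funext t
      by_cases ht : t ∈ U
      · rw [Set.piecewise_eq_of_mem _ _ _ ht, hin t ht]
      · rw [Set.piecewise_eq_of_notMem _ _ _ ht, hout t ht]
    refine dominates_equivariant hp hk hm hh₁ (hpw ▸ hh'.piecewise hU hh₁) (fun t _ => ?_)
      (fun t _ htne => ?_) (hne.trans_le (measure_mono fun t ht => ⟨(hsub ht.1).1, ?_⟩)) hfin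
    · by_cases ht : t ∈ U
      · rw [hin t ht]
        exact (hb t ht).2
      · rw [hout t ht]
    · have ht : t ∈ U := by
        by_contra hcon
        exact htne (hout t hcon)
      rw [hin t ht]
      linarith [(hb t ht).1]
    · rw [hin t ht.1]
      exact ht.2
  · refine dominates_equivariant hp hk hm hh₁ (measurable_hBU hp k m 0) hle
      (fun t ht _ => by linarith [hle t ht]) ?_ (hasFiniteRisk_hBU hp hk hm)
    simpa only [ne_comm] using hne
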